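/- Setting. Let $X$ be a separable metric space and $\mu$ a Radon measure on $X$ (a locally finite Borel measure, inner regular with respect to compact sets). Fragments. Let $\mathrm{Frag}(X)$ be the set of biLipschitz maps $\gamma:K\to X$ with $K=\operatorname{dom}\gamma\subset\mathbb R$ compact of positive Lebesgue measure, with the topology of the Hausdorff distance between the graphs in $\mathbb R\times X$. Alberti representations. An Alberti representation $\mathcal A=(P,\nu)$ of $\mu$ consists of a Borel probability measure $P$ on $\mathrm{Frag}(X)$ and a Borel map $\gamma\mapsto\nu_\gamma$ into the finite (nonnegative) Borel measures on $X$ such that: $\nu_\gamma\ll\mathcal H^1\llcorner\operatorname{im}\gamma$ for every $\gamma$; $\mu(A)=\int\nu_\gamma(A)\,dP(\gamma)$ for every Borel $A$; and $\gamma\mapsto\nu_\gamma(A\cap\gamma([a,b]\cap\operatorname{dom}\gamma))$ is Borel for every Borel $A$ and all $a\le b$. It is Lipschitz if for some $C$ $P$-a.e. $\gamma$ is $C$-Lipschitz. Derivations. A derivation is a bounded linear, weak* continuous map $D:\mathrm{Lip}_b(X)\to L^\infty(\mu)$ with $D(fg)=f\,Dg+g\,Df$, where $\mathrm{Lip}_b(X)$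 is the algebra of bounded real Lipschitz functions with norm $\max(\|f\|_\infty,\mathrm{Lip}(f))$. Here $f_n\to f$ weak* in $\mathrm{Lip}_b(X)$ means that $(f_n)$ is bounded in norm and converges pointwise, and $L^\infty(\mu)$ carries its weak* topology as the dual of $L^1(\mu)$. By locality $D$ extends to all Lipschitz functions ($Df=Dg$ a.e. on $\{f=g\}$ for $g\in\mathrm{Lip}_b(X)$), and it acts on Lipschitz maps $f:X\to\mathbb R^q$ componentwise. Derivations $D_1,\dots,D_k$ are linearly independent if $\sum_i\lambda_iD_i=0$ with $\lambda_i\in L^\infty(\mu)$ implies $\lambda_i=0$ for all $i$. For a Lipschitz Alberti representation $\mathcal A=(P,\nu)$ of $\mu$, the associated derivation $D_{\mathcal A}$ is the derivation determined by $$\int_X g\,D_{\mathcal A}f\,d\mu=\int_{\mathrm{Frag}(X)}\int_X g\,\partial_\gamma f\,d\nu_\gamma\,dP(\gamma)$$ for all $f\in\mathrm{Lip}_b(X)$ and all bounded Borel $g\in L^1(\mu)$, where $\partial_\gamma f(x)=(f\circ\gamma)'(\gamma^{-1}(x))$ if $x\in\operatorname{im}\gamma$ and the derivative exists, and $\partial_\gamma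 f(x)=0$ otherwise. Cone fields. For $w\in S^{q-1}$ and $\alpha\in(0,\pi/2)$ let $C(w,\alpha)=\{u\in\mathbb R^q:\tan\alpha\,\langle w,u\rangle>\|u-\langle w,u\rangle w\|_2\}$. A cone field $C(v,\alpha)$ is given by Borel maps $v:X\to S^{q-1}$ and $\alpha:X\to(0,\pi/2)$. For $f:X\to\mathbb R^q$ Lipschitz, $\mathcal A=(P,\nu)$ is in the $f$-direction of $C(v,\alpha)$ if for $P$-a.e. $\gamma$ and Lebesgue-a.e. $t\in\operatorname{dom}\gamma$ one has $(f\circ\gamma)'(t)\in C(v(\gamma(t)),\alpha(\gamma(t)))$. Cone fields $C_1,\dots,C_k$ are independent if for each $x\in X$ all choices of $u_i\in C_i(x)\setminus\{0\}$ give linearly independent vectors $u_1,\dots,u_k$. Theorem. Let $f:X\to\mathbb R^q$ be Lipschitz. (1) If a Lipschitz Alberti representation $\mathcal A$ of $\mu$ is in the $f$-direction of a cone field $C(v,\alpha)$, then there is a unique derivation $D_{\mathcal A}$ associated with $\mathcal A$, and $D_{\mathcal A}f(x)\in C(v(x),\alpha(x))$ for $\mu$-a.e. $x\in X$. (2) If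 Lipschitz Alberti representations $\mathcal A_1,\dots,\mathcal A_k$ of $\mu$ are in the $f$-directions of independent cone fields $C(v_1,\alpha_1),\dots,C(v_k,\alpha_k)$ respectively, then the derivations $D_{\mathcal A_1},\dots,D_{\mathcal A_k}$ are linearly independent. -/

import Mathlib

open MeasureTheory Set Filter Topology
open scoped NNReal ENNReal BoundedContinuousFunction

namespace AlbertiDer

/-! ### Curve fragments -/

/-- A path fragment in `X`: a biLipschitz map `γ : K → X` where `K ⊆ ℝ` is compact and has positive
Lebesgue measure. -/
structure Fragment (X : Type*) [MetricSpace X] where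
  dom : Set ℝ
  isCompact_dom : IsCompact dom
  volume_dom_pos : 0 < volume dom
  toFun : dom → X
  bilipschitz : ∃ K : ℝ≥0, LipschitzWith K toFun ∧ AntilipschitzWith K toFun

namespace Fragment

variable {X : Type*} [MetricSpace X]

instance : CoeFun (Fragment X) (fun γ => γ.dom → X) := ⟨Fragment.toFun⟩

theorem continuous (γ : Fragment X) : Continuous γ.toFun := by
  obtain ⟨K, hK, -⟩ := γ.bilipschitz
  exact hK.continuous

theorem dom_nonempty (γ : Fragment X) : γ.dom.Nonempty :=
  nonempty_of_measure_ne_zero γ.volume_dom_pos.ne'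

/-- The graph of a fragment, a nonempty compact subset of `ℝ × X`. -/
def graph (γ : Fragment X) : TopologicalSpace.NonemptyCompacts (ℝ × X) where
  carrier := range (fun t : γ.dom => ((t : ℝ), γ t))
  isCompact' := by
    have : CompactSpace γ.dom := isCompact_iff_compactSpace.mp γ.isCompact_dom
    exact isCompact_range (continuous_subtype_val.prodMk γ.continuous)
  nonempty' := by
    have : Nonempty γ.dom := γ.dom_nonempty.to_subtype
    exact range_nonempty _

/-- The space of fragments is identified, through graphs, with a subspace of the space of compact
subsets of `ℝ × X` with the Vietoris topology (that is, the topology of the Hausdorff distance). -/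
instance : TopologicalSpace (Fragment X) := TopologicalSpace.induced graph inferInstance

instance : MeasurableSpace (Fragment X) := borel _

instance : BorelSpace (Fragment X) := ⟨rfl⟩

/-- `γ([a,b] ∩ dom γ)`. -/
def arc (γ : Fragment X) (a b : ℝ) : Set X := γ.toFun '' {t | (t : ℝ) ∈ Icc a b}

variable {E : Type*} [NormedAddCommGroup E] [NormedSpace ℝ E]

/-- The derivative `(f ∘ γ)'(t)` along `dom γ`. The composition `f ∘ γ`, which is only defined on
`dom γ`, is extended by `0` to `ℝ`; the derivative within `dom γ` does not see this extension. The
value is `0` where the derivative does not exist and at the isolated points of `dom γ`. -/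
noncomputable def derivAlong (γ : Fragment X) (f : X → E) (t : ℝ) : E :=
  derivWithin (Function.extend (Subtype.val : γ.dom → ℝ) (fun s => f (γ s)) 0) γ.dom t

open Classical in
/-- `∂_γ f (x) = (f ∘ γ)'(γ⁻¹ x)` if `x` lies in the image of `γ` and the derivative exists,
and `0` otherwise. -/
noncomputable def partialDeriv (γ : Fragment X) (f : X → E) (x : X) : E :=
  if h : ∃ t : γ.dom, γ t = x then γ.derivAlong f h.choose else 0

end Fragment

/-! ### Bounded Lipschitz functions and derivations -/

/-- The algebra `Lip_b(X)` of bounded real-valued Lipschitz functions on `X`. -/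
def LipAlg (X : Type*) [MetricSpace X] : Subalgebra ℝ (X →ᵇ ℝ) where
  carrier := {f | ∃ K : ℝ≥0, LipschitzWith K f}
  mul_mem' := by
    rintro f g ⟨K, hK⟩ ⟨L, hL⟩
    refine ⟨‖f‖₊ * L + ‖g‖₊ * K, LipschitzWith.of_dist_le_mul fun x y => ?_⟩
    have h1 := hK.dist_le_mul x y
    have h2 := hL.dist_le_mul x y
    have h3 := f.norm_coe_le_norm x
    have h4 := g.norm_coe_le_norm y
    rw [Real.dist_eq] at h1 h2
    rw [Real.norm_eq_abs] at h3 h4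
    rw [Real.dist_eq]
    have e : (f * g) x - (f * g) y = f x * (g x - g y) + g y * (f x - f y) := by
      simp only [BoundedContinuousFunction.coe_mul, Pi.mul_apply]; ring
    rw [e]
    refine (abs_add_le _ _).trans ?_
    rw [abs_mul, abs_mul]
    push_cast
    have h5 : |f x| * |g x - g y| ≤ ‖f‖ * (L * dist x y) :=
      mul_le_mul h3 h2 (abs_nonneg _) (norm_nonneg _)
    have h6 : |g y| * |f x - f y| ≤ ‖g‖ * (K * dist x y) :=
      mul_le_mul h4 h1 (abs_nonneg _) (norm_nonneg _)
    linarith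
  add_mem' := by
    rintro f g ⟨K, hK⟩ ⟨L, hL⟩
    exact ⟨K + L, hK.add hL⟩
  algebraMap_mem' := fun r => ⟨0, LipschitzWith.const r⟩

/-- The norm `max (‖f‖_∞, Lip f)` of `Lip_b(X)`, where `Lip f` is the least Lipschitz constant. -/
noncomputable def lipNorm {X : Type*} [MetricSpace X] (f : LipAlg X) : ℝ :=
  max ‖f.1‖ ((sInf {K : ℝ≥0 | LipschitzWith K f.1} : ℝ≥0) : ℝ)

/-- Truncation `max (min f n) (-n)` of a Lipschitz function, as an element of `Lip_b(X)`. -/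
noncomputable def trunc {X : Type*} [MetricSpace X] (f : X → ℝ) (hf : ∃ K : ℝ≥0, LipschitzWith K f)
    (n : ℕ) : LipAlg X :=
  have hL : ∃ K : ℝ≥0, LipschitzWith K (fun x => max (min (f x) n) (-(n : ℝ))) :=
    hf.imp fun _ hK => (hK.min_const _).max_const _
  ⟨BoundedContinuousFunction.ofNormedAddCommGroup
      (fun x => max (min (f x) n) (-(n : ℝ))) hL.choose_spec.continuous n (fun x => by
        have hn : (0 : ℝ) ≤ n := n.cast_nonneg
        rw [Real.norm_eq_abs, abs_le]
        exact ⟨le_max_right _ _, max_le (min_le_right _ _) (by linarith)⟩), hL⟩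

/-- A (Weaver) derivation with respect to `μ`: a bounded linear map `D : Lip_b(X) → L^∞(μ)` which
satisfies the product rule and is weak* continuous. For separable `X` weak* continuity can be tested
on sequences, and `u n → f` weak* in `Lip_b(X)` means that `u n` is bounded in `Lip_b(X)` and
converges to `f` pointwise; the weak* topology of `L^∞(μ)` is that of the dual of `L^1(μ)`. -/
@[ext]
structure WeaverDerivation {X : Type*} [MetricSpace X] [MeasurableSpace X] (μ : Measure X) where
  toLin : LipAlg X →ₗ[ℝ] Lp ℝ ∞ μ
  bounded : ∃ C : ℝ, ∀ f, ‖toLin f‖ ≤ C * lipNorm f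
  leibniz : ∀ f g : LipAlg X,
    toLin (f * g) =ᵐ[μ] fun x => f.1 x * toLin g x + g.1 x * toLin f x
  weakStar_continuous : ∀ (u : ℕ → LipAlg X) (f : LipAlg X),
    (∃ M : ℝ, ∀ n, lipNorm (u n) ≤ M) →
    (∀ x, Tendsto (fun n => (u n).1 x) atTop (𝓝 (f.1 x))) →
    ∀ g : X → ℝ, Integrable g μ →
      Tendsto (fun n => ∫ x, g x * toLin (u n) x ∂μ) atTop (𝓝 (∫ x, g x * toLin f x ∂μ))

namespace WeaverDerivation

variable {X : Type*} [MetricSpace X] [MeasurableSpace X] {μ : Measure X}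

noncomputable instance : Zero (WeaverDerivation μ) where
  zero :=
    { toLin := 0
      bounded := ⟨0, fun f => by simp⟩
      leibniz := fun f g => by
        filter_upwards [Lp.coeFn_zero ℝ ∞ μ] with x hx
        simp only [LinearMap.zero_apply, hx, Pi.zero_apply, mul_zero, add_zero]
      weakStar_continuous := fun u f _ _ g _ => by
        simp only [LinearMap.zero_apply]
        exact tendsto_const_nhds }

/-- The extension of a derivation to a possibly unbounded Lipschitz function `f`. Derivations are
local (if bounded Lipschitz functions agree on a set, then their images agree a.e. on it), so `D f`
is determined by `D f = D g` a.e. on `{f = g}` for `g` bounded Lipschitz; here the truncation of `f`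
at level `n + 1` is used on `{n ≤ |f| < n + 1}`. -/
noncomputable def applyLip (D : WeaverDerivation μ) (f : X → ℝ)
    (hf : ∃ K : ℝ≥0, LipschitzWith K f) (x : X) : ℝ :=
  D.toLin (trunc f hf (⌊|f x|⌋₊ + 1)) x

/-- `D f = (D f_1, …, D f_q)` for a Lipschitz map `f = (f_1, …, f_q) : X → ℝ^q`. -/
noncomputable def applyVec (D : WeaverDerivation μ) {q : ℕ} (f : X → EuclideanSpace ℝ (Fin q))
    (hf : ∃ K : ℝ≥0, LipschitzWith K f) (x : X) : EuclideanSpace ℝ (Fin q) :=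
  WithLp.toLp 2 fun j => D.applyLip (fun y => f y j)
    (hf.imp fun _ hK => LipschitzWith.of_dist_le_mul fun y z =>
      (PiLp.dist_apply_le (f y) (f z) j).trans (hK.dist_le_mul y z)) x

/-- Linear independence in the `L^∞(μ)`-module of derivations: `∑ i, c i • D i = 0` with
coefficients `c i ∈ L^∞(μ)` only if all the `c i` vanish. -/
def LinIndep {k : ℕ} (D : Fin k → WeaverDerivation μ) : Prop :=
  ∀ c : Fin k → Lp ℝ ∞ μ,
    (∀ f : LipAlg X, ∑ i, (c i • (D i).toLin f : Lp ℝ ∞ μ) = 0) → ∀ i, c i = 0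

end WeaverDerivation

/-! ### Cone fields -/

/-- The open cone in `ℝ^q` with axis `w` and opening angle `α`. -/
noncomputable def cone {q : ℕ} (w : EuclideanSpace ℝ (Fin q)) (α : ℝ) :
    Set (EuclideanSpace ℝ (Fin q)) :=
  {u | ‖u - inner ℝ w u • w‖ < Real.tan α * inner ℝ w u}

/-- A `q`-dimensional cone field on `X`: a Borel map from `X` to `S^{q-1} × (0, π/2)`. -/
structure ConeField (X : Type*) [MeasurableSpace X] (q : ℕ) where
  axis : X → EuclideanSpace ℝ (Fin q)
  angle : X → ℝ
  norm_axis : ∀ x, ‖axis x‖ = 1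
  angle_mem : ∀ x, angle x ∈ Ioo 0 (Real.pi / 2)
  measurable_axis : Measurable axis
  measurable_angle : Measurable angle

/-- The cone at `x` of a cone field. -/
noncomputable def ConeField.coneAt {X : Type*} [MeasurableSpace X] {q : ℕ} (C : ConeField X q) (x : X) :
    Set (EuclideanSpace ℝ (Fin q)) :=
  cone (C.axis x) (C.angle x)

/-- Cone fields are independent if at each point nonzero vectors chosen from the respective cones
are always linearly independent. -/
def IndepConeFields {X : Type*} [MeasurableSpace X] {q k : ℕ} (C : Fin k → ConeField X q) : Prop :=
  ∀ x, ∀ v : Fin k → EuclideanSpace ℝ (Fin q),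
    (∀ i, v i ∈ (C i).coneAt x \ {0}) → LinearIndependent ℝ v

/-! ### Alberti representations -/

/-- An Alberti representation `(P, ν)` of `μ`. Measurability of `ν` is with respect to the
`σ`-algebra generated by the maps `ν ↦ ν s`, `s` Borel. -/
structure AlbertiRep {X : Type*} [MetricSpace X] [MeasurableSpace X] [BorelSpace X]
    (μ : Measure X) where
  P : Measure (Fragment X)
  isProbabilityMeasure : IsProbabilityMeasure P
  ν : Fragment X → Measure X
  isFiniteMeasure : ∀ γ, IsFiniteMeasure (ν γ)
  measurable_ν : Measurable ν
  absolutelyContinuous : ∀ γ : Fragment X,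
    ν γ ≪ (Measure.hausdorffMeasure 1 : Measure X).restrict (range γ.toFun)
  represents : ∀ s, MeasurableSet s → μ s = ∫⁻ γ, ν γ s ∂P
  measurable_arc : ∀ s, MeasurableSet s → ∀ a b : ℝ, a ≤ b →
    Measurable fun γ : Fragment X => ν γ (s ∩ γ.arc a b)

namespace AlbertiRep

variable {X : Type*} [MetricSpace X] [MeasurableSpace X] [BorelSpace X] {μ : Measure X}

/-- A Lipschitz Alberti representation: for some `C`, almost every fragment is `C`-Lipschitz. -/
def IsLipschitz (A : AlbertiRep μ) : Prop :=
  ∃ C : ℝ≥0, ∀ᵐ γ ∂A.P, LipschitzWith C γ.toFun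

/-- `A` is in the `f`-direction of the cone field `C`: for `P`-a.e. `γ` and a.e. `t ∈ dom γ` one has
`(f ∘ γ)'(t) ∈ C (γ t)`. Open cones do not contain `0`, so the derivative has to exist there. -/
def InDirection (A : AlbertiRep μ) {q : ℕ} (f : X → EuclideanSpace ℝ (Fin q))
    (C : ConeField X q) : Prop :=
  ∀ᵐ γ ∂A.P, ∀ᵐ t : ℝ, ∀ ht : t ∈ γ.dom, γ.derivAlong f t ∈ C.coneAt (γ.toFun ⟨t, ht⟩)

/-- `D` is the derivation associated with `A`:
`∫ g (D f) dμ = ∫ dP(γ) ∫ g ∂_γ f dν_γ` for `f ∈ Lip_b(X)` and `g ∈ L^1(μ)` bounded Borel. -/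
def Induces (A : AlbertiRep μ) (D : WeaverDerivation μ) : Prop :=
  ∀ f : LipAlg X, ∀ g : X → ℝ, Measurable g → (∃ M : ℝ, ∀ x, |g x| ≤ M) → Integrable g μ →
    ∫ x, g x * D.toLin f x ∂μ = ∫ γ, ∫ x, g x * γ.partialDeriv f.1 x ∂(A.ν γ) ∂A.P

open Classical in
/-- The derivation `D_A` associated with the Alberti representation `A`. -/
noncomputable def derivation (A : AlbertiRep μ) : WeaverDerivation μ :=
  if h : ∃ D, A.Induces D then h.choose else 0

end AlbertiRep

end AlbertiDer

/-! A representation is the same as a measure dν_γ dP(γ) on pairs (γ, x), `AlbertiRep.total`, whose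
second marginal is μ. On pairs, the derivative of a Lipschitz f along γ at x is an essentially
bounded function when the fragments are uniformly Lipschitz, and D_A f must be its conditional
expectation given x. This fibre average exists as a Radon–Nikodym density (`exists_isFiberAverage`)
and is determined by its integrals, so linearity and the Leibniz rule are inherited from
one-variable calculus along each fragment.

Two points need real work. To speak of a function of pairs at all, the derivative needs a jointly
measurable version: `Fragment.measDeriv` is an upper derivative read off the graph of γ, which suits
the Vietoris topology. For weak* continuity, dominated convergence over γ reduces to a single
fragment, and its inverse moves the problem to the line. There uniformly Lipschitz functions
converging pointwise on a compact set converge uniformly, and integration by parts against a smooth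
approximation of the density gives weak convergence of the derivatives
(`tendsto_integral_mul_derivWithin`).

The cone at x is convex, and an average of vectors from it remains inside: if it escaped on a set of
positive measure, one measurable field of dual vectors would detect it
(`ae_mem_coneAt_of_isFiberAverage`). Since cones omit 0, independent cone fields make the vectors
D_i f(x) linearly independent for a.e. x, so any relation with L^∞ coefficients vanishes pointwise.
-/

namespace AlbertiDer

/-! ### Averaging bounded functions along the fibres of a measure-preserving map -/

section FiberAverage

variable {Ω X : Type*} [MeasurableSpace Ω] [MeasurableSpace X] {m : Measure Ω} {μ : Measure X}
  {π : Ω → X}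

/-- `u : X → ℝ` is the average of `h : Ω → ℝ` along the fibres of `π : Ω → X`. -/
def IsFiberAverage (m : Measure Ω) (μ : Measure X) (π : Ω → X) (h : Ω → ℝ) (u : X → ℝ) : Prop :=
  ∀ g : X → ℝ, Integrable g μ → ∫ x, g x * u x ∂μ = ∫ ω, g (π ω) * h ω ∂m

/-- Adding B makes h nonnegative, so (h + B) m is a measure; its image under π is at most 2B μ,
hence has a density with values in [0, 2B]. Subtracting B recovers the average of h together with
the bound |u| ≤ B. -/
theorem exists_isFiberAverage [SFinite m] [SigmaFinite μ] (hπ : MeasurePreserving π m μ)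
    {h : Ω → ℝ} (hm : Measurable h) {B : ℝ} (hB0 : 0 ≤ B) (hB : ∀ᵐ ω ∂m, |h ω| ≤ B) :
    ∃ u : X → ℝ, Measurable u ∧ (∀ᵐ x ∂μ, |u x| ≤ B) ∧ IsFiberAverage m μ π h u := by
  set d : Ω → ℝ≥0∞ := fun ω => ENNReal.ofReal (h ω + B) with hd
  have hdm : Measurable d := (hm.add_const B).ennreal_ofReal
  set l : Measure X := (m.withDensity d).map π with hl
  have hle : ∀ s, MeasurableSet s → l s ≤ ENNReal.ofReal (2 * B) * μ s := by
    intro s hs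
    rw [hl, Measure.map_apply hπ.measurable hs, withDensity_apply _ (hπ.measurable hs),
      ← hπ.measure_preimage hs.nullMeasurableSet, ← setLIntegral_const]
    refine lintegral_mono_ae (ae_restrict_of_ae ?_)
    filter_upwards [hB] with ω hω
    exact ENNReal.ofReal_le_ofReal (by linarith [(abs_le.mp hω).2])
  have hac : l ≪ μ := by
    refine Measure.AbsolutelyContinuous.mk fun s hs h0 => ?_
    have := hle s hs
    rw [h0, mul_zero] at this
    exact le_antisymm this zero_le
  set ρ := l.rnDeriv μ with hρ
  have hρm : Measurable ρ := Measure.measurable_rnDeriv _ _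
  have hlρ : l = μ.withDensity ρ := (Measure.withDensity_rnDeriv_eq l μ hac).symm
  have hρB : ∀ᵐ x ∂μ, ρ x ≤ ENNReal.ofReal (2 * B) := by
    refine ae_le_of_forall_setLIntegral_le_of_sigmaFinite hρm fun s hs _ => ?_
    rw [← withDensity_apply _ hs, ← hlρ, setLIntegral_const]
    exact hle s hs
  have hρtop : ∀ᵐ x ∂μ, ρ x < ∞ := hρB.mono fun x hx => hx.trans_lt ENNReal.ofReal_lt_top
  have hub : ∀ᵐ x ∂μ, |(ρ x).toReal - B| ≤ B := by
    filter_upwards [hρB] with x hx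
    have h1 := ENNReal.toReal_mono ENNReal.ofReal_ne_top hx
    rw [ENNReal.toReal_ofReal (by linarith)] at h1
    have h2 : 0 ≤ (ρ x).toReal := ENNReal.toReal_nonneg
    exact abs_le.mpr ⟨by linarith, by linarith⟩
  refine ⟨fun x => (ρ x).toReal - B, hρm.ennreal_toReal.sub_const B, hub, fun g hg => ?_⟩
  have hgπ : Integrable (fun ω => g (π ω)) m := hπ.integrable_comp_of_integrable hg
  have e1 : ∫ x, g x * (ρ x).toReal ∂μ = ∫ ω, g (π ω) * (h ω + B) ∂m := by
    have a1 : ∫ x, g x ∂l = ∫ x, (ρ x).toReal • g x ∂μ := by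
      rw [hlρ, integral_withDensity_eq_integral_toReal_smul hρm hρtop]
    have a2 : ∫ x, g x ∂l = ∫ ω, (d ω).toReal • g (π ω) ∂m := by
      rw [hl, integral_map hπ.measurable.aemeasurable,
        integral_withDensity_eq_integral_toReal_smul hdm
          (ae_of_all _ fun ω => ENNReal.ofReal_lt_top)]
      exact hg.1.mono_ac hac
    calc ∫ x, g x * (ρ x).toReal ∂μ = ∫ x, (ρ x).toReal • g x ∂μ := by
          simp only [smul_eq_mul, mul_comm]
      _ = ∫ ω, (d ω).toReal • g (π ω) ∂m := by rw [← a1, a2]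
      _ = _ := by
          refine integral_congr_ae ?_
          filter_upwards [hB] with ω hω
          simp only [hd, smul_eq_mul]
          rw [ENNReal.toReal_ofReal (by linarith [(abs_le.mp hω).1]), mul_comm]
  have i1 : Integrable (fun x => g x * (ρ x).toReal) μ := by
    refine hg.mul_bdd (c := 2 * B) hρm.ennreal_toReal.aestronglyMeasurable ?_
    filter_upwards [hub] with x hx
    rw [Real.norm_eq_abs, abs_of_nonneg ENNReal.toReal_nonneg]
    linarith [(abs_le.mp hx).2]
  have i2 : Integrable (fun ω => g (π ω) * h ω) m :=
    hgπ.mul_bdd (c := B) hm.aestronglyMeasurable hB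
  simp only [mul_sub]
  rw [integral_sub i1 (hg.mul_const B), e1]
  simp only [mul_add]
  rw [integral_add i2 (hgπ.mul_const B), integral_mul_const, integral_mul_const,
    ← hπ.map_eq, integral_map hπ.measurable.aemeasurable (by rw [hπ.map_eq]; exact hg.1)]
  ring

/-- Essentially bounded functions are determined by their integrals against bounded measurable
integrable functions. -/
theorem ae_eq_of_forall_integral_mul_eq [SigmaFinite μ] (u v : Lp ℝ ∞ μ)
    (huv : ∀ g : X → ℝ, Measurable g → (∃ M : ℝ, ∀ x, |g x| ≤ M) → Integrable g μ →
      ∫ x, g x * u x ∂μ = ∫ x, g x * v x ∂μ) : u = v := by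
  have hI : ∀ (w : Lp ℝ ∞ μ) s, MeasurableSet s → μ s < ∞ → IntegrableOn w s μ := by
    intro w s hs hμs
    have : IsFiniteMeasure (μ.restrict s) := ⟨by simpa using hμs⟩
    exact ((Lp.memLp w).restrict s).integrable le_top
  refine Lp.ext (ae_eq_of_forall_setIntegral_eq_of_sigmaFinite (hI u) (hI v) fun s hs hμs => ?_)
  have := huv (s.indicator 1) (measurable_one.indicator hs)
    ⟨1, fun x => by by_cases hx : x ∈ s <;> simp [hx]⟩
    ((integrable_indicator_iff hs).mpr (integrableOn_const hμs.ne))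
  rw [← integral_indicator hs, ← integral_indicator hs]
  convert! this using 2 <;>
  · ext x
    by_cases hx : x ∈ s <;> simp [hx]

end FiberAverage

/-! ### Cone-valued vector fields and their fibre averages -/

section FiberAverageCone

variable {Ω X : Type*} [MeasurableSpace Ω] [MeasurableSpace X] {m : Measure Ω} {μ : Measure X}
  {π : Ω → X} {q : ℕ}

theorem mem_cone_iff {w u : EuclideanSpace ℝ (Fin q)} {α : ℝ} (hα : α ∈ Ioo 0 (Real.pi / 2)) :
    u ∈ cone w α ↔ 0 < Real.sin α * inner ℝ w u - Real.cos α * ‖u - inner ℝ w u • w‖ := by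
  have hc : 0 < Real.cos α := Real.cos_pos_of_mem_Ioo ⟨by linarith [hα.1, hα.2], hα.2⟩
  rw [cone, mem_ofPred_eq, Real.tan_eq_sin_div_cos, div_mul_eq_mul_div, lt_div_iff₀ hc, sub_pos,
    mul_comm]

theorem zero_notMem_cone {w : EuclideanSpace ℝ (Fin q)} {α : ℝ} : 0 ∉ cone w α := by
  simp [cone]

theorem measurableSet_coneAt_comp (C : ConeField X q) {Y : Type*} [MeasurableSpace Y] {p : Y → X}
    (hp : Measurable p) {V : Y → EuclideanSpace ℝ (Fin q)} (hV : Measurable V) :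
    MeasurableSet {y | V y ∈ C.coneAt (p y)} := by
  have hw : Measurable fun y => C.axis (p y) := C.measurable_axis.comp hp
  have ha : Measurable fun y => C.angle (p y) := C.measurable_angle.comp hp
  have hi : Measurable fun y => inner ℝ (C.axis (p y)) (V y) := hw.inner (𝕜 := ℝ) hV
  have : {y | V y ∈ C.coneAt (p y)} = {y | 0 < Real.sin (C.angle (p y)) * inner ℝ (C.axis (p y)) (V y)
      - Real.cos (C.angle (p y)) * ‖V y - inner ℝ (C.axis (p y)) (V y) • C.axis (p y)‖} := by
    ext y
    exact mem_cone_iff (C.angle_mem _)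
  rw [this]
  refine measurableSet_lt measurable_const (Measurable.sub ?_ ?_)
  · exact (Real.measurable_sin.comp ha).mul hi
  · exact (Real.measurable_cos.comp ha).mul (hV.sub (Measurable.fun_smul hi hw)).norm

/-- Fibre averages of vector fields with values in a cone field stay in the cone field. -/
theorem ae_mem_coneAt_of_isFiberAverage [SigmaFinite μ] (hπ : MeasurePreserving π m μ)
    (C : ConeField X q) {U : X → EuclideanSpace ℝ (Fin q)} (hU : Measurable U)
    {V : Ω → EuclideanSpace ℝ (Fin q)} (hV : Measurable V) {B : ℝ}
    (hUB : ∀ᵐ x ∂μ, ∀ j, |U x j| ≤ B) (hVB : ∀ᵐ ω ∂m, ∀ j, |V ω j| ≤ B)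
    (havg : ∀ j, IsFiberAverage m μ π (fun ω => V ω j) (fun x => U x j))
    (hC : ∀ᵐ ω ∂m, V ω ∈ C.coneAt (π ω)) : ∀ᵐ x ∂μ, U x ∈ C.coneAt x := by
  have hw := C.measurable_axis
  have ha := C.measurable_angle
  set r : X → EuclideanSpace ℝ (Fin q) → EuclideanSpace ℝ (Fin q) :=
    fun x u => u - inner ℝ (C.axis x) u • C.axis x with hr
  -- The unit vector along the part of U orthogonal to the axis. Where that part vanishes, `0⁻¹ = 0`
  -- gives e = 0, and the identity `hηU` persists.
  set e : X → EuclideanSpace ℝ (Fin q) := fun x => ‖r x (U x)‖⁻¹ • r x (U x) with he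
  have hem : Measurable e := by
    have : Measurable fun x => r x (U x) := hU.sub (Measurable.fun_smul (hw.inner (𝕜 := ℝ) hU) hw)
    exact this.norm.inv.smul this
  have he1 : ∀ x, ‖e x‖ ≤ 1 := fun x => by
    rw [he, norm_smul, norm_inv, norm_norm]
    exact inv_mul_le_one
  -- η(x) is a dual vector adapted to U(x): since ‖e‖ ≤ 1, its pairing with any u dominates the
  -- functional sin α ⟨w,u⟩ − cos α ‖u − ⟨w,u⟩w‖ whose positivity defines the cone, with equality at
  -- u = U(x).
  set η : X → EuclideanSpace ℝ (Fin q) := fun x =>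
    Real.sin (C.angle x) • C.axis x - Real.cos (C.angle x) • r x (e x) with hη
  have hηm : Measurable η := by
    have h1 : Measurable fun x => r x (e x) := hem.sub (Measurable.fun_smul (hw.inner (𝕜 := ℝ) hem) hw)
    exact ((Real.measurable_sin.comp ha).smul hw).sub ((Real.measurable_cos.comp ha).smul h1)
  have hηb : ∀ x, ‖η x‖ ≤ 3 := fun x => by
    have h1 : ‖r x (e x)‖ ≤ 2 := by
      have h2 : |inner ℝ (C.axis x) (e x)| ≤ 1 := by
        refine (abs_real_inner_le_norm _ _).trans ?_
        rw [C.norm_axis, one_mul]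
        exact he1 x
      calc ‖r x (e x)‖ ≤ ‖e x‖ + ‖inner ℝ (C.axis x) (e x) • C.axis x‖ := norm_sub_le _ _
        _ ≤ 1 + 1 := by
          refine add_le_add (he1 x) ?_
          rwa [norm_smul, C.norm_axis, mul_one]
        _ = 2 := by norm_num
    calc ‖η x‖ ≤ ‖Real.sin (C.angle x) • C.axis x‖ + ‖Real.cos (C.angle x) • r x (e x)‖ :=
          norm_sub_le _ _
      _ ≤ 1 + 1 * 2 := by
          rw [norm_smul, norm_smul, C.norm_axis, mul_one]
          exact add_le_add (Real.abs_sin_le_one _)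
            (mul_le_mul (Real.abs_cos_le_one _) h1 (norm_nonneg _) zero_le_one)
      _ = 3 := by norm_num
  have hηu : ∀ x u, inner ℝ (η x) u =
      Real.sin (C.angle x) * inner ℝ (C.axis x) u - Real.cos (C.angle x) * inner ℝ (e x) (r x u) := by
    intro x u
    simp only [hη, hr, inner_sub_left, inner_sub_right, real_inner_smul_left,
      real_inner_smul_right]
    rw [real_inner_comm (C.axis x) (e x)]
    ring
  have hηU : ∀ x, inner ℝ (η x) (U x) =
      Real.sin (C.angle x) * inner ℝ (C.axis x) (U x) - Real.cos (C.angle x) * ‖r x (U x)‖ := by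
    intro x
    rw [hηu, he, real_inner_smul_left, real_inner_self_eq_norm_sq]
    rcases eq_or_ne ‖r x (U x)‖ 0 with h0 | h0
    · simp [h0]
    · field_simp
  have hηV : ∀ᵐ ω ∂m, 0 < inner ℝ (η (π ω)) (V ω) := by
    filter_upwards [hC] with ω hω
    have hα := C.angle_mem (π ω)
    refine ((mem_cone_iff hα).mp hω).trans_le ?_
    rw [hηu]
    have h1 : inner ℝ (e (π ω)) (r (π ω) (V ω)) ≤ ‖r (π ω) (V ω)‖ :=
      (real_inner_le_norm _ _).trans (mul_le_of_le_one_left (norm_nonneg _) (he1 _))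
    have h2 : 0 ≤ Real.cos (C.angle (π ω)) :=
      Real.cos_nonneg_of_mem_Icc ⟨by linarith [hα.1, hα.2], hα.2.le⟩
    exact sub_le_sub_left (mul_le_mul_of_nonneg_left h1 h2) _
  have hsm : MeasurableSet {x | inner ℝ (η x) (U x) ≤ 0} :=
    measurableSet_le (hηm.inner (𝕜 := ℝ) hU) measurable_const
  suffices h0 : μ {x | inner ℝ (η x) (U x) ≤ 0} = 0 by
    filter_upwards [measure_eq_zero_iff_ae_notMem.mp h0] with x hx
    rw [ConeField.coneAt, mem_cone_iff (C.angle_mem x), ← hηU]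
    simpa using hx
  -- On a subset t of finite positive measure the bounded field η is integrable, so its coordinates
  -- are admissible tests. The integral of ⟨η, U⟩ over t is then nonpositive but equals that of ⟨η,
  -- V⟩ over the preimage of t, which is positive.
  by_contra hne
  obtain ⟨t, htm, hts, ht0, httop⟩ :=
    Measure.exists_subset_measure_lt_top hsm (pos_iff_ne_zero.mpr hne)
  have hcoord : ∀ x j, |η x j| ≤ 3 := fun x j => (PiLp.norm_apply_le (η x) j).trans (hηb x)
  set g : Fin q → X → ℝ := fun j => t.indicator fun x => η x j with hg
  have hηj : ∀ j, Measurable fun x => η x j := fun j => by fun_prop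
  have hgi : ∀ j, Integrable (g j) μ := by
    intro j
    rw [hg, integrable_indicator_iff htm]
    exact Measure.integrableOn_of_bounded httop.ne (hηj j).aestronglyMeasurable
      (ae_of_all _ fun x => hcoord x j)
  have hUj : ∀ j, Integrable (fun x => g j x * U x j) μ := fun j =>
    (hgi j).mul_bdd (c := B) (by fun_prop) (hUB.mono fun x hx => hx j)
  have hVj : ∀ j, Integrable (fun ω => g j (π ω) * V ω j) m := fun j =>
    (hπ.integrable_comp_of_integrable (hgi j)).mul_bdd (c := B) (by fun_prop)
      (hVB.mono fun x hx => hx j)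
  have eU : ∀ x, ∑ j, g j x * U x j = t.indicator (fun x => inner ℝ (η x) (U x)) x := by
    intro x
    by_cases hx : x ∈ t
    · simp [hg, hx, PiLp.inner_apply, mul_comm]
    · simp [hg, hx]
  have eV : ∀ ω, ∑ j, g j (π ω) * V ω j =
      (π ⁻¹' t).indicator (fun ω => inner ℝ (η (π ω)) (V ω)) ω := by
    intro ω
    by_cases hx : π ω ∈ t
    · simp [hg, hx, PiLp.inner_apply, mul_comm]
    · simp [hg, hx]
  have key : ∫ x in t, inner ℝ (η x) (U x) ∂μ = ∫ ω in π ⁻¹' t, inner ℝ (η (π ω)) (V ω) ∂m := by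
    rw [← integral_indicator htm, ← integral_indicator (hπ.measurable htm)]
    simp only [← eU, ← eV]
    rw [integral_finsetSum _ fun j _ => hUj j, integral_finsetSum _ fun j _ => hVj j]
    exact Finset.sum_congr rfl fun j _ => havg j _ (hgi j)
  have hVi : IntegrableOn (fun ω => inner ℝ (η (π ω)) (V ω)) (π ⁻¹' t) m := by
    rw [← integrable_indicator_iff (hπ.measurable htm)]
    rw [← funext eV]
    exact integrable_finsetSum _ fun j _ => hVj j
  have neg : ∫ x in t, inner ℝ (η x) (U x) ∂μ ≤ 0 :=
    setIntegral_nonpos htm fun x hx => hts hx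
  have pos : 0 < ∫ ω in π ⁻¹' t, inner ℝ (η (π ω)) (V ω) ∂m := by
    rw [setIntegral_pos_iff_support_of_nonneg_ae
      (ae_restrict_of_ae (hηV.mono fun ω hω => hω.le)) hVi]
    have : m (π ⁻¹' t) = μ t := hπ.measure_preimage htm.nullMeasurableSet
    rw [measure_congr (t := π ⁻¹' t), this]
    · exact ht0
    · filter_upwards [hηV] with ω hω
      refine propext ⟨fun h => h.2, fun h => ⟨?_, h⟩⟩
      exact hω.ne'
  linarith

end FiberAverageCone

/-! ### Derivatives of Lipschitz functions on compact subsets of the line -/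

/-- Only countably many points of a subset of the line are isolated from the right within it; every
other point of the set is an accumulation point. -/
theorem ae_uniqueDiffWithinAt_real (K : Set ℝ) : ∀ᵐ t : ℝ, t ∈ K → UniqueDiffWithinAt ℝ K t := by
  have hc := countable_setOfPred_isolated_right_within (s := K)
  filter_upwards [hc.ae_notMem volume] with t ht htK
  rw [uniqueDiffWithinAt_iff_accPt, accPt_principal_iff_nhdsWithin]
  have h1 : (𝓝[K ∩ Ioi t] t).NeBot := ⟨fun h => ht ⟨htK, h⟩⟩
  exact h1.mono (nhdsWithin_mono _ fun s hs => ⟨hs.1, (mem_Ioi.mp hs.2).ne'⟩)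

theorem ae_hasDerivWithinAt_of_eqOn_lipschitz {K : Set ℝ} {F G : ℝ → ℝ} {L : ℝ≥0}
    (hG : LipschitzWith L G) (hFG : EqOn F G K) :
    ∀ᵐ t : ℝ, t ∈ K → HasDerivWithinAt F (deriv G t) K t := by
  filter_upwards [hG.ae_differentiableAt_real] with t ht htK
  exact ht.hasDerivAt.hasDerivWithinAt.congr hFG (hFG htK)

theorem ae_derivWithin_eq_of_eqOn_lipschitz {K : Set ℝ} {F G : ℝ → ℝ} {L : ℝ≥0}
    (hG : LipschitzWith L G) (hFG : EqOn F G K) :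
    ∀ᵐ t : ℝ, t ∈ K → derivWithin F K t = deriv G t := by
  filter_upwards [ae_hasDerivWithinAt_of_eqOn_lipschitz hG hFG, ae_uniqueDiffWithinAt_real K]
    with t h1 h2 htK
  exact (h1 htK).derivWithin (h2 htK)

/-- Replace h by a smooth compactly supported g close in L¹: the error is controlled by |G'| ≤ L,
and in ∫ g G' = −∫ g' G only the size of G matters. Thus ε depends on h, L and η, but not on G. -/
theorem exists_forall_lipschitz_abs_integral_mul_deriv_le {h : ℝ → ℝ} (hh : Integrable h)
    (L : ℝ≥0) {η : ℝ} (hη : 0 < η) :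
    ∃ ε > 0, ∀ G : ℝ → ℝ, LipschitzWith L G → (∀ t, |G t| ≤ ε) →
      |∫ t, h t * deriv G t| ≤ η := by
  have hL : (0 : ℝ) < L + 1 := by positivity
  obtain ⟨g, hgc, hgs, hgη⟩ := (memLp_one_iff_integrable.mpr hh).exist_eLpNorm_sub_le
    ENNReal.one_ne_top le_rfl (ε := η / 2 / (L + 1)) (by positivity)
  obtain ⟨D, hD⟩ := hgs.lipschitzWith_of_hasCompactSupport hgc (by simp)
  have hgi : Integrable g := hgs.continuous.integrable_of_hasCompactSupport hgc
  have hdc : Continuous (deriv g) := hgs.continuous_deriv (by simp)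
  have hdi : Integrable (deriv g) := hdc.integrable_of_hasCompactSupport hgc.deriv
  set I := ∫ t, |deriv g t| with hI
  have hI0 : 0 ≤ I := integral_nonneg fun t => abs_nonneg _
  -- The integral of |g' G| is at most I ε, and the approximation error is at most η/2; the added 1
  -- keeps the denominator positive.
  refine ⟨η / 2 / (I + 1), by positivity, fun G hG hGε => ?_⟩
  have hdG : ∀ t, ‖deriv G t‖ ≤ L := fun t => norm_deriv_le_of_lipschitz hG
  have hdGm : AEStronglyMeasurable (deriv G) volume :=
    (measurable_deriv G).aestronglyMeasurable
  have i1 : Integrable fun t => (h t - g t) * deriv G t :=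
    (hh.sub hgi).mul_bdd hdGm (ae_of_all _ hdG)
  have i2 : Integrable fun t => g t * deriv G t := hgi.mul_bdd hdGm (ae_of_all _ hdG)
  have b1 : |∫ t, (h t - g t) * deriv G t| ≤ η / 2 := by
    have hn : ∫ t, ‖h t - g t‖ ≤ η / 2 / (L + 1) := by
      have : ∫ t, ‖h t - g t‖ = (eLpNorm (h - g) 1 volume).toReal := by
        rw [eLpNorm_one_eq_lintegral_enorm]
        exact integral_norm_eq_lintegral_enorm (hh.sub hgi).1
      rw [this]
      exact ENNReal.toReal_le_of_le_ofReal (by positivity) hgη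
    calc |∫ t, (h t - g t) * deriv G t| ≤ ∫ t, ‖h t - g t‖ * L := by
          rw [← Real.norm_eq_abs]
          refine norm_integral_le_of_norm_le (hh.sub hgi |>.norm.mul_const (L : ℝ)) (ae_of_all _ fun t => ?_)
          rw [norm_mul]
          exact mul_le_mul_of_nonneg_left (hdG t) (norm_nonneg _)
      _ = (∫ t, ‖h t - g t‖) * L := integral_mul_const _ _
      _ ≤ η / 2 / (L + 1) * (L + 1) :=
          mul_le_mul hn (by linarith) L.coe_nonneg (by positivity)
      _ = η / 2 := by field_simp
  have e2 : ∫ t, g t * deriv G t = ∫ t, -(deriv g t) * G t := by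
    have := LipschitzWith.integral_lineDeriv_mul_eq (μ := volume) hG hD hgc (1 : ℝ)
    have hl : ∀ (f : ℝ → ℝ) t, lineDeriv ℝ f t 1 = deriv f t := fun f t => by
      simp only [lineDeriv, smul_eq_mul, mul_one]
      rw [deriv_comp_const_add, add_zero]
    simp only [lineDeriv_neg, hl] at this
    rw [← this]
    simp only [mul_comm]
  have b2 : |∫ t, g t * deriv G t| ≤ η / 2 := by
    rw [e2]
    calc |∫ t, -(deriv g t) * G t| ≤ ∫ t, |deriv g t| * (η / 2 / (I + 1)) := by
          rw [← Real.norm_eq_abs]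
          refine norm_integral_le_of_norm_le (hdi.abs.mul_const _) (ae_of_all _ fun t => ?_)
          rw [norm_mul, norm_neg]
          exact mul_le_mul_of_nonneg_left (hGε t) (norm_nonneg _)
      _ = I * (η / 2 / (I + 1)) := integral_mul_const _ _
      _ ≤ (I + 1) * (η / 2 / (I + 1)) :=
          mul_le_mul_of_nonneg_right (by linarith) (by positivity)
      _ = η / 2 := by field_simp
  have e : ∫ t, h t * deriv G t = (∫ t, (h t - g t) * deriv G t) + ∫ t, g t * deriv G t := by
    rw [← integral_add i1 i2]
    congr with t
    ring
  rw [e]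
  linarith [abs_add_le (∫ t, (h t - g t) * deriv G t) (∫ t, g t * deriv G t)]

/-- The Arzelà–Ascoli principle: on a compact set, pointwise convergence of an equicontinuous family
is uniform. -/
theorem tendstoUniformlyOn_of_lipschitzOnWith {K : Set ℝ} (hK : IsCompact K) {L : ℝ≥0}
    {F : ℕ → ℝ → ℝ} {F₀ : ℝ → ℝ} (hF : ∀ n, LipschitzOnWith L (F n) K)
    (hlim : ∀ t ∈ K, Tendsto (fun n => F n t) atTop (𝓝 (F₀ t))) :
    TendstoUniformlyOn F F₀ atTop K := by
  have : CompactSpace K := isCompact_iff_compactSpace.mp hK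
  have hequi : Equicontinuous fun n => K.domRestrict (F n) :=
    (LipschitzWith.uniformEquicontinuous _ L fun n => (hF n).to_restrict).equicontinuous
  have h := (hequi.tendsto_uniformFun_iff_pi atTop (K.domRestrict F₀)).mpr
    (tendsto_pi_nhds.mpr fun t => hlim t t.2)
  rw [tendstoUniformlyOn_iff_tendstoUniformly_comp_coe]
  exact UniformFun.tendsto_iff_tendstoUniformly.mp h

theorem aestronglyMeasurable_derivWithin {K : Set ℝ} {σ : Measure ℝ} (hσ : σ ≪ volume)
    (hσK : ∀ᵐ t ∂σ, t ∈ K) {L : ℝ≥0} {F : ℝ → ℝ} (hF : LipschitzOnWith L F K) :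
    AEStronglyMeasurable (fun t => derivWithin F K t) σ := by
  obtain ⟨G, hG, hFG⟩ := hF.extend_real
  refine (measurable_deriv G).aestronglyMeasurable.congr ?_
  filter_upwards [hσ.ae_le (ae_derivWithin_eq_of_eqOn_lipschitz hG hFG), hσK] with t h1 h2
  exact (h1 h2).symm

/-- If uniformly Lipschitz functions on a compact set converge pointwise, then their derivatives
converge weakly against absolutely continuous measures. -/
theorem tendsto_integral_mul_derivWithin {K : Set ℝ} (hK : IsCompact K) {σ : Measure ℝ}
    [SigmaFinite σ] (hσ : σ ≪ volume) (hσK : ∀ᵐ t ∂σ, t ∈ K) {h : ℝ → ℝ} (hh : Integrable h σ)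
    {L : ℝ≥0} {F : ℕ → ℝ → ℝ} {F₀ : ℝ → ℝ} (hF : ∀ n, LipschitzOnWith L (F n) K)
    (hF₀ : LipschitzOnWith L F₀ K) (hlim : ∀ t ∈ K, Tendsto (fun n => F n t) atTop (𝓝 (F₀ t))) :
    Tendsto (fun n => ∫ t, h t * derivWithin (F n) K t ∂σ) atTop
      (𝓝 (∫ t, h t * derivWithin F₀ K t ∂σ)) := by
  have hd : ∀ {F G : ℝ → ℝ} {L : ℝ≥0}, LipschitzWith L G → EqOn F G K →
      ∀ᵐ t ∂σ, derivWithin F K t = deriv G t := fun hG hFG => by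
    filter_upwards [hσ.ae_le (ae_derivWithin_eq_of_eqOn_lipschitz hG hFG), hσK] with t h1 h2
    exact h1 h2
  have hint : ∀ {F : ℝ → ℝ}, LipschitzOnWith L F K →
      Integrable (fun t => h t * derivWithin F K t) σ := by
    intro F hF
    obtain ⟨G, hG, hFG⟩ := hF.extend_real
    have hG' : Integrable (fun t => h t * deriv G t) σ :=
      hh.mul_bdd (measurable_deriv G).aestronglyMeasurable
        (ae_of_all _ fun t => norm_deriv_le_of_lipschitz hG)
    refine hG'.congr ?_
    filter_upwards [hd hG hFG] with t ht
    rw [ht]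
  set ρ : ℝ → ℝ := fun t => (σ.rnDeriv volume t).toReal with hρ
  have hρh : Integrable fun t => ρ t * h t := (integrable_rnDeriv_smul_iff hσ).mpr hh
  rw [Metric.tendsto_atTop]
  intro η hη
  obtain ⟨ε, hε, hGε⟩ :=
    exists_forall_lipschitz_abs_integral_mul_deriv_le hρh (L + L) (half_pos hη)
  have hu := Metric.tendstoUniformlyOn_iff.mp (tendstoUniformlyOn_of_lipschitzOnWith hK hF hlim) ε hε
  obtain ⟨N, hN⟩ := eventually_atTop.mp hu
  refine ⟨N, fun n hn => ?_⟩
  -- The difference is small only on K. Extending it to a Lipschitz function on the line and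
  -- truncating at ±ε makes it small everywhere, without changing it on K or increasing its
  -- Lipschitz constant.
  obtain ⟨G₀, hG₀, hFG₀⟩ := ((hF n).sub hF₀).extend_real
  have hG : LipschitzWith (L + L) fun t => max (min (G₀ t) ε) (-ε) :=
    (hG₀.min_const ε).max_const (-ε)
  set G : ℝ → ℝ := fun t => max (min (G₀ t) ε) (-ε) with hGdef
  have hFG : EqOn (fun t => F n t - F₀ t) G K := by
    intro t ht
    have h1 := hN n hn t ht
    rw [dist_comm, Real.dist_eq] at h1
    have h2 := hFG₀ ht
    rw [abs_lt] at h1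
    simp only [hGdef, ← h2]
    rw [min_eq_left h1.2.le, max_eq_left h1.1.le]
  have hGb : ∀ t, |G t| ≤ ε := fun t =>
    abs_le.mpr ⟨le_max_right _ _, max_le (min_le_right _ _) (by linarith)⟩
  -- `derivWithin` is additive only where both functions are differentiable, which holds a.e.
  -- through their Lipschitz extensions.
  have hsub : ∀ᵐ t ∂σ, derivWithin (F n) K t - derivWithin F₀ K t = deriv G t := by
    obtain ⟨G₁, hG₁, hFG₁⟩ := (hF n).extend_real
    obtain ⟨G₂, hG₂, hFG₂⟩ := hF₀.extend_real
    filter_upwards [hd hG hFG, hσ.ae_le (ae_hasDerivWithinAt_of_eqOn_lipschitz hG₁ hFG₁),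
      hσ.ae_le (ae_hasDerivWithinAt_of_eqOn_lipschitz hG₂ hFG₂), hσK,
      hσ.ae_le (ae_uniqueDiffWithinAt_real K)] with t h1 h2 h3 h4 h5
    rw [← h1, ← derivWithin_fun_sub (h2 h4).differentiableWithinAt (h3 h4).differentiableWithinAt]
  have e : (∫ t, h t * derivWithin (F n) K t ∂σ) - ∫ t, h t * derivWithin F₀ K t ∂σ =
      ∫ t, ρ t * h t * deriv G t := by
    rw [← integral_sub (hint (hF n)) (hint hF₀)]
    simp only [mul_assoc]
    rw [show (∫ t, ρ t * (h t * deriv G t)) = ∫ t, h t * deriv G t ∂σ from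
      integral_rnDeriv_smul hσ]
    refine integral_congr_ae ?_
    filter_upwards [hsub] with t ht
    rw [← ht]
    ring
  rw [Real.dist_eq, e]
  exact (hGε G hG hGb).trans_lt (half_lt_self hη)

/-! ### Measurability on the space of fragments -/

namespace Fragment

variable {X : Type*} [MetricSpace X]

theorem continuous_graph : Continuous (graph : Fragment X → _) := continuous_induced_dom

theorem mem_graph {γ : Fragment X} {p : ℝ × X} : p ∈ γ.graph ↔ ∃ t : γ.dom, ((t : ℝ), γ t) = p :=
  Iff.rfl

/-- In the Vietoris topology, meeting an open set is an open condition on the graph. -/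
theorem isOpen_setOf_exists_mem_graph {Z : Type*} [TopologicalSpace Z] {W : Set ((ℝ × X) × Z)}
    (hW : IsOpen W) : IsOpen {ω : Fragment X × Z | ∃ p ∈ ω.1.graph, (p, ω.2) ∈ W} := by
  rw [isOpen_iff_mem_nhds]
  rintro ⟨γ, z⟩ ⟨p, hp, hpz⟩
  obtain ⟨U, V, hU, hV, hpU, hzV, hUV⟩ := isOpen_prod_iff.mp hW p z hpz
  have hO : IsOpen {γ : Fragment X | ((γ.graph : Set (ℝ × X)) ∩ U).Nonempty} :=
    (TopologicalSpace.NonemptyCompacts.isOpen_inter_nonempty_of_isOpen hU).preimage continuous_graph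
  filter_upwards [prod_mem_nhds (hO.mem_nhds ⟨p, hp, hpU⟩) (hV.mem_nhds hzV)]
  rintro ⟨γ', z'⟩ ⟨⟨p', hp', hpU'⟩, hz'⟩
  exact ⟨p', hp', hUV ⟨hpU', hz'⟩⟩

/-- The graph is compact, so by the tube lemma missing a closed set persists under small changes of
both the graph and the parameter. -/
theorem isClosed_setOf_exists_mem_graph {Z : Type*} [TopologicalSpace Z] {W : Set ((ℝ × X) × Z)}
    (hW : IsClosed W) : IsClosed {ω : Fragment X × Z | ∃ p ∈ ω.1.graph, (p, ω.2) ∈ W} := by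
  rw [← isOpen_compl_iff, isOpen_iff_mem_nhds]
  rintro ⟨γ, z⟩ hγz
  have hsub : (γ.graph : Set (ℝ × X)) ×ˢ {z} ⊆ Wᶜ := by
    rintro ⟨p, _⟩ ⟨hp, rfl⟩ hpW
    exact hγz ⟨p, hp, hpW⟩
  obtain ⟨U, V, hU, hV, hγU, hzV, hUV⟩ :=
    generalized_tube_lemma γ.graph.isCompact isCompact_singleton hW.isOpen_compl hsub
  have hO : IsOpen {γ : Fragment X | (γ.graph : Set (ℝ × X)) ⊆ U} :=
    (TopologicalSpace.NonemptyCompacts.isOpen_subsets_of_isOpen hU).preimage continuous_graph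
  filter_upwards [prod_mem_nhds (hO.mem_nhds hγU) (hV.mem_nhds (singleton_subset_iff.mp hzV))]
  rintro ⟨γ', z'⟩ ⟨hγ', hz'⟩ ⟨p, hp, hpW⟩
  exact hUV ⟨hγ' hp, hz'⟩ hpW

theorem injective (γ : Fragment X) : Function.Injective γ.toFun := by
  obtain ⟨K, -, hK⟩ := γ.bilipschitz
  exact hK.injective

/-- The inverse of a fragment, extended by `0`. -/
noncomputable def param (γ : Fragment X) : X → ℝ := Function.extend γ.toFun Subtype.val 0

theorem param_apply (γ : Fragment X) (t : γ.dom) : γ.param (γ t) = t :=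
  γ.injective.extend_apply _ _ _

theorem partialDeriv_apply {E : Type*} [NormedAddCommGroup E] [NormedSpace ℝ E] (γ : Fragment X)
    (f : X → E) (t : γ.dom) : γ.partialDeriv f (γ t) = γ.derivAlong f t := by
  have h : ∃ s : γ.dom, γ s = γ t := ⟨t, rfl⟩
  rw [partialDeriv, dif_pos h, γ.injective h.choose_spec]

/-- The composition `f ∘ γ`, extended by `0`. -/
noncomputable def pullback {E : Type*} [Zero E] (γ : Fragment X) (f : X → E) : ℝ → E :=
  Function.extend (Subtype.val : γ.dom → ℝ) (fun s => f (γ s)) 0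

theorem pullback_apply {E : Type*} [Zero E] (γ : Fragment X) (f : X → E) {t : ℝ} (ht : t ∈ γ.dom) :
    γ.pullback f t = f (γ.toFun ⟨t, ht⟩) :=
  Subtype.val_injective.extend_apply _ _ (⟨t, ht⟩ : γ.dom)

/-- The supremum of the difference quotients of `f` from `(t, x)` to points of the graph of `γ`
whose first coordinate has distance less than `1 / (n + 1)` from `t`. -/
noncomputable def slopeSup (f : X → ℝ) (n : ℕ) (ω : Fragment X × (ℝ × X)) : EReal :=
  ⨆ s : ω.1.dom, ⨆ _ : (s : ℝ) ≠ ω.2.1 ∧ |(s : ℝ) - ω.2.1| < 1 / ((n : ℝ) + 1),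
    (((f (ω.1 s) - f ω.2.2) / (s - ω.2.1) : ℝ) : EReal)

/-- The supremum exceeds c exactly when the graph meets an open set depending on (t, x). Letting (t,
x) range off the graph as well is what makes this an open condition on a product. -/
theorem lowerSemicontinuous_slopeSup {f : X → ℝ} (hf : Continuous f) (n : ℕ) :
    LowerSemicontinuous (slopeSup f n) := by
  rw [lowerSemicontinuous_iff_isOpen_preimage]
  intro c
  have hO : IsOpen {z : (ℝ × X) × (ℝ × X) | z.1.1 ≠ z.2.1} :=
    isOpen_ne_fun (by fun_prop) (by fun_prop)
  have hc : ContinuousOn (fun z : (ℝ × X) × (ℝ × X) =>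
      (((f z.1.2 - f z.2.2) / (z.1.1 - z.2.1) : ℝ) : EReal))
      {z : (ℝ × X) × (ℝ × X) | z.1.1 ≠ z.2.1} := by
    refine continuous_coe_real_ereal.comp_continuousOn (ContinuousOn.div ?_ ?_ ?_)
    · fun_prop
    · fun_prop
    · exact fun z hz => sub_ne_zero.mpr hz
  have hW := (hc.isOpen_inter_preimage hO (isOpen_Ioi (a := c))).inter
    (isOpen_lt (f := fun z : (ℝ × X) × (ℝ × X) => |z.1.1 - z.2.1|)
      (g := fun _ => 1 / ((n : ℝ) + 1)) (by fun_prop) (by fun_prop))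
  convert! isOpen_setOf_exists_mem_graph hW using 1
  ext ω
  simp only [slopeSup, mem_preimage, mem_Ioi, lt_iSup_iff, mem_ofPred_eq, mem_graph, mem_inter_iff]
  constructor
  · rintro ⟨s, hs, h⟩
    exact ⟨_, ⟨s, rfl⟩, ⟨hs.1, h⟩, hs.2⟩
  · rintro ⟨_, ⟨s, rfl⟩, ⟨h1, h2⟩, h3⟩
    exact ⟨s, ⟨h1, h3⟩, h2⟩

/-- A jointly measurable version of the derivative of `f` along fragments. -/
noncomputable def measDeriv (f : X → ℝ) (ω : Fragment X × X) : ℝ :=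
  (⨅ n : ℕ, slopeSup f n (ω.1, (ω.1.param ω.2, ω.2))).toReal

/-- The infimum over n is the limsup of the difference quotients, so it is the derivative where that
exists. Unique differentiability gives points of the domain near t, without which the suprema would
be over empty sets. -/
theorem measDeriv_apply {f : X → ℝ} {γ : Fragment X} {t : γ.dom} {d : ℝ}
    (hd : HasDerivWithinAt (γ.pullback f) d
      γ.dom t) (hu : UniqueDiffWithinAt ℝ γ.dom t) :
    measDeriv f (γ, γ t) = d := by
  have hlim := (continuous_coe_real_ereal.tendsto d).comp (hasDerivWithinAt_iff_tendsto_slope.mp hd)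
  have hne : (𝓝[γ.dom \ {(t : ℝ)}] (t : ℝ)).NeBot := by
    rw [uniqueDiffWithinAt_iff_accPt, accPt_principal_iff_nhdsWithin] at hu
    exact hu
  rw [measDeriv, param_apply]
  suffices h : ⨅ n : ℕ, slopeSup f n (γ, ((t : ℝ), γ t)) = (d : EReal) by rw [h, EReal.toReal_coe]
  have hslope : ∀ s : γ.dom, slope (γ.pullback f) t s = (f (γ s) - f (γ t)) / (s - t) := fun s => by
    rw [slope_def_field, pullback_apply γ f s.2, pullback_apply γ f t.2]
  refine le_antisymm (le_of_forall_gt_imp_ge_of_dense fun a ha => ?_) (le_iInf fun n => ?_)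
  · have h1 := hlim.eventually_lt_const ha
    rw [eventually_nhdsWithin_iff, Metric.eventually_nhds_iff] at h1
    obtain ⟨ε, hε, h1⟩ := h1
    obtain ⟨n, hn⟩ := exists_nat_one_div_lt hε
    refine (iInf_le _ n).trans (iSup_le fun s => iSup_le fun hs => ?_)
    have h2 := h1 (y := s) (by rw [Real.dist_eq]; exact hs.2.trans hn) ⟨s.2, hs.1⟩
    rw [Function.comp_apply, hslope] at h2
    exact h2.le
  · refine le_of_forall_lt_imp_le_of_dense fun a ha => ?_
    have h1 := hlim.eventually_const_lt ha
    have h2 : ∀ᶠ s : ℝ in 𝓝[γ.dom \ {(t : ℝ)}] (t : ℝ), |s - t| < 1 / ((n : ℝ) + 1) :=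
      nhdsWithin_le_nhds (Metric.ball_mem_nhds _ Nat.one_div_pos_of_nat)
    obtain ⟨s, ⟨h3, h4⟩, h5⟩ := ((h1.and h2).and self_mem_nhdsWithin).exists
    rw [Function.comp_apply, hslope ⟨s, h5.1⟩] at h3
    exact h3.le.trans (le_iSup₂_of_le (⟨s, h5.1⟩ : γ.dom) ⟨h5.2, h4⟩ le_rfl)

theorem lipschitzOnWith_pullback {f : X → ℝ} {L C : ℝ≥0} (hf : LipschitzWith L f) {γ : Fragment X}
    (hγ : LipschitzWith C γ.toFun) :
    LipschitzOnWith (L * C) (γ.pullback f)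
      γ.dom := by
  rw [lipschitzOnWith_iff_restrict]
  have : γ.dom.domRestrict (γ.pullback f) =
      f ∘ γ.toFun := by
    ext s
    exact pullback_apply γ f s.2
  rw [this]
  exact hf.comp hγ

theorem ae_hasDerivWithinAt_derivAlong {f : X → ℝ} {L C : ℝ≥0} (hf : LipschitzWith L f)
    {γ : Fragment X} (hγ : LipschitzWith C γ.toFun) :
    ∀ᵐ t : ℝ, t ∈ γ.dom → UniqueDiffWithinAt ℝ γ.dom t ∧
      HasDerivWithinAt (γ.pullback f)
        (γ.derivAlong f t) γ.dom t ∧ |γ.derivAlong f t| ≤ L * C := by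
  obtain ⟨G, hG, hfG⟩ := (lipschitzOnWith_pullback hf hγ).extend_real
  filter_upwards [ae_hasDerivWithinAt_of_eqOn_lipschitz hG hfG,
    ae_uniqueDiffWithinAt_real γ.dom] with t h1 h2 ht
  have h3 : γ.derivAlong f t = deriv G t := (h1 ht).derivWithin (h2 ht)
  refine ⟨h2 ht, h3 ▸ h1 ht, ?_⟩
  rw [h3, ← Real.norm_eq_abs]
  exact_mod_cast norm_deriv_le_of_lipschitz hG

theorem ae_hasDerivWithinAt_measDeriv {f : X → ℝ} {L C : ℝ≥0} (hf : LipschitzWith L f)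
    {γ : Fragment X} (hγ : LipschitzWith C γ.toFun) :
    ∀ᵐ t : ℝ, ∀ ht : t ∈ γ.dom, UniqueDiffWithinAt ℝ γ.dom t ∧
      HasDerivWithinAt (γ.pullback f) (measDeriv f (γ, γ.toFun ⟨t, ht⟩)) γ.dom t ∧
      |measDeriv f (γ, γ.toFun ⟨t, ht⟩)| ≤ L * C := by
  filter_upwards [ae_hasDerivWithinAt_derivAlong hf hγ] with t h ht
  obtain ⟨h1, h2, h3⟩ := h ht
  rw [measDeriv_apply (t := ⟨t, ht⟩) h2 h1]
  exact ⟨h1, h2, h3⟩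

/-! ### Null sets along fragments and joint measurability -/

section Measurable

variable [MeasurableSpace X] [BorelSpace X]

theorem measurableEmbedding (γ : Fragment X) : MeasurableEmbedding γ.toFun := by
  have : CompactSpace γ.dom := isCompact_iff_compactSpace.mp γ.isCompact_dom
  exact (γ.continuous.isClosedEmbedding γ.injective).measurableEmbedding

theorem measurable_param (γ : Fragment X) : Measurable γ.param :=
  γ.measurableEmbedding.measurable_extend measurable_subtype_coe measurable_const

/-- A fragment is Lipschitz, so it maps Lebesgue null sets to sets of zero length, which ρ does not
charge. -/
theorem ae_exists_of_ae_volume {γ : Fragment X} {ρ : Measure X}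
    (hρ : ρ ≪ (Measure.hausdorffMeasure 1 : Measure X).restrict (range γ.toFun)) {p : ℝ → Prop}
    (hp : ∀ᵐ t : ℝ, p t) : ∀ᵐ x ∂ρ, ∃ t : γ.dom, γ t = x ∧ p t := by
  suffices h : ∀ᵐ x ∂(Measure.hausdorffMeasure 1 : Measure X).restrict (range γ.toFun),
      ∃ t : γ.dom, γ t = x ∧ p t from hρ.ae_le h
  rw [ae_restrict_iff' γ.measurableEmbedding.measurableSet_range]
  obtain ⟨K, hK, -⟩ := γ.bilipschitz
  have h0 : Measure.hausdorffMeasure 1 {t : γ.dom | ¬ p t} = 0 := by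
    rw [← isometry_subtype_coe.hausdorffMeasure_image (Or.inl zero_le_one), hausdorffMeasure_real]
    exact measure_mono_null (by rintro _ ⟨t, ht, rfl⟩; exact ht) hp
  have h1 := hK.hausdorffMeasure_image_le zero_le_one {t : γ.dom | ¬ p t}
  rw [h0, mul_zero, nonpos_iff_eq_zero] at h1
  refine measure_mono_null ?_ h1
  rintro x hx
  simp only [mem_compl_iff, mem_ofPred_eq, not_forall] at hx
  obtain ⟨⟨t, rfl⟩, hx⟩ := hx
  exact ⟨t, fun ht => hx ⟨t, rfl, ht⟩, rfl⟩

theorem map_param_absolutelyContinuous {γ : Fragment X} {ρ : Measure X}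
    (hρ : ρ ≪ (Measure.hausdorffMeasure 1 : Measure X).restrict (range γ.toFun)) :
    ρ.map γ.param ≪ volume := by
  refine Measure.AbsolutelyContinuous.mk fun N hN h0 => ?_
  rw [Measure.map_apply γ.measurable_param hN]
  rw [measure_eq_zero_iff_ae_notMem]
  filter_upwards [ae_exists_of_ae_volume hρ (measure_eq_zero_iff_ae_notMem.mp h0)] with x hx
  obtain ⟨t, rfl, ht⟩ := hx
  simpa [param_apply] using ht

theorem ae_measDeriv {f : X → ℝ} {L C : ℝ≥0} (hf : LipschitzWith L f) {γ : Fragment X}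
    (hγ : LipschitzWith C γ.toFun) {ρ : Measure X}
    (hρ : ρ ≪ (Measure.hausdorffMeasure 1 : Measure X).restrict (range γ.toFun)) :
    ∀ᵐ x ∂ρ, measDeriv f (γ, x) = γ.partialDeriv f x ∧ |measDeriv f (γ, x)| ≤ L * C := by
  filter_upwards [ae_exists_of_ae_volume hρ (ae_hasDerivWithinAt_derivAlong hf hγ)] with x hx
  obtain ⟨t, rfl, ht⟩ := hx
  obtain ⟨h1, h2, h3⟩ := ht t.2
  rw [measDeriv_apply h2 h1, partialDeriv_apply]
  exact ⟨rfl, h3⟩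

variable [TopologicalSpace.SeparableSpace X]

theorem measurable_uncurry_param : Measurable fun ω : Fragment X × X => ω.1.param ω.2 := by
  have : SecondCountableTopology X := UniformSpace.secondCountable_of_separable X
  have hc : ∀ S : Set ℝ, IsClosed S →
      MeasurableSet {ω : Fragment X × X | ∃ p ∈ ω.1.graph, p.2 = ω.2 ∧ p.1 ∈ S} := by
    intro S hS
    have hW : IsClosed {z : (ℝ × X) × X | z.1.2 = z.2 ∧ z.1.1 ∈ S} :=
      (isClosed_eq (by fun_prop) (by fun_prop)).inter
        (hS.preimage (by fun_prop : Continuous fun z : (ℝ × X) × X => z.1.1))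
    exact (isClosed_setOf_exists_mem_graph hW).measurableSet
  refine measurable_of_Iic fun b => ?_
  -- Off the image of γ the parameter has the default value 0, so such points count exactly when 0 ≤
  -- b.
  convert! (hc (Iic b) isClosed_Iic).union ((hc univ isClosed_univ).compl.inter
    (MeasurableSet.const (0 ≤ b))) using 1
  ext ⟨γ, x⟩
  by_cases hx : ∃ t, γ.toFun t = x
  · obtain ⟨t, rfl⟩ := hx
    simp only [mem_preimage, param_apply, mem_Iic, mem_union, mem_ofPred_eq, mem_inter_iff,
      mem_compl_iff, mem_univ, and_true]
    constructor
    · exact fun h => Or.inl ⟨_, ⟨t, rfl⟩, rfl, h⟩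
    · rintro (⟨_, ⟨s, rfl⟩, h1, h2⟩ | ⟨h, -⟩)
      · rwa [← γ.injective h1]
      · exact absurd ⟨_, ⟨t, rfl⟩, rfl⟩ h
  · have h0 : γ.param x = 0 := Function.extend_apply' _ _ _ hx
    simp only [mem_preimage, h0, mem_Iic, mem_union, mem_ofPred_eq, mem_inter_iff,
      mem_compl_iff, mem_univ, and_true]
    constructor
    · refine fun h => Or.inr ⟨?_, h⟩
      rintro ⟨_, ⟨s, rfl⟩, h1⟩
      exact hx ⟨s, h1⟩
    · rintro (⟨_, ⟨s, rfl⟩, h1, h2⟩ | ⟨-, h⟩)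
      · exact absurd ⟨s, h1⟩ hx
      · exact h

theorem measurable_measDeriv {f : X → ℝ} (hf : Continuous f) :
    Measurable (measDeriv f : Fragment X × X → ℝ) := by
  have : SecondCountableTopology X := UniformSpace.secondCountable_of_separable X
  have h : Measurable fun ω : Fragment X × X => (ω.1, (ω.1.param ω.2, ω.2)) :=
    measurable_fst.prodMk (measurable_uncurry_param.prodMk measurable_snd)
  exact (Measurable.iInf fun n =>
    (lowerSemicontinuous_slopeSup hf n).measurable.comp h).ereal_toReal

end Measurable

end Fragment

/-! ### Linearity and uniqueness of fibre averages -/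

section FiberAverageAlgebra

variable {Ω X : Type*} [MeasurableSpace Ω] [MeasurableSpace X] {m : Measure Ω} {μ : Measure X}
  {π : Ω → X}

theorem IsFiberAverage.congr {h h' : Ω → ℝ} {u u' : X → ℝ} (hu : IsFiberAverage m μ π h u)
    (hh' : h =ᵐ[m] h') (huu' : u =ᵐ[μ] u') : IsFiberAverage m μ π h' u' := by
  intro g hg
  rw [← integral_congr_ae (huu'.mono fun x hx => congrArg (g x * ·) hx), hu g hg]
  exact integral_congr_ae (hh'.mono fun ω hω => congrArg (g (π ω) * ·) hω)

/-- Fibre averages are linear over bounded functions on the base. -/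
theorem IsFiberAverage.mul_add_mul (hπ : MeasurePreserving π m μ) {h₁ h₂ : Ω → ℝ} {u₁ u₂ : X → ℝ}
    (hh₁ : MemLp h₁ ∞ m) (hh₂ : MemLp h₂ ∞ m) (hu₁ : MemLp u₁ ∞ μ) (hu₂ : MemLp u₂ ∞ μ)
    (H₁ : IsFiberAverage m μ π h₁ u₁) (H₂ : IsFiberAverage m μ π h₂ u₂) {a₁ a₂ : X → ℝ}
    (ha₁ : MemLp a₁ ∞ μ) (ha₂ : MemLp a₂ ∞ μ) :
    IsFiberAverage m μ π (fun ω => a₁ (π ω) * h₁ ω + a₂ (π ω) * h₂ ω)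
      (fun x => a₁ x * u₁ x + a₂ x * u₂ x) := by
  intro g hg
  have g₁ : Integrable (fun x => g x * a₁ x) μ := hg.mul_of_top_left ha₁
  have g₂ : Integrable (fun x => g x * a₂ x) μ := hg.mul_of_top_left ha₂
  have i₁ := g₁.mul_of_top_left hu₁
  have i₂ := g₂.mul_of_top_left hu₂
  have j₁ := (hπ.integrable_comp_of_integrable g₁).mul_of_top_left hh₁
  have j₂ := (hπ.integrable_comp_of_integrable g₂).mul_of_top_left hh₂
  have e₁ := H₁ _ g₁
  have e₂ := H₂ _ g₂
  simp only [mul_add, ← mul_assoc]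
  exact (integral_add i₁ i₂).trans ((congrArg₂ (· + ·) e₁ e₂).trans (integral_add j₁ j₂).symm)

theorem IsFiberAverage.ae_eq [SigmaFinite μ] {h : Ω → ℝ} {u v : X → ℝ} (hu : MemLp u ∞ μ)
    (hv : MemLp v ∞ μ) (Hu : IsFiberAverage m μ π h u) (Hv : IsFiberAverage m μ π h v) :
    u =ᵐ[μ] v := by
  have := ae_eq_of_forall_integral_mul_eq (hu.toLp u) (hv.toLp v) fun g _ _ hg => by
    rw [integral_congr_ae (hu.coeFn_toLp.mono fun x hx => congrArg (g x * ·) hx),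
      integral_congr_ae (hv.coeFn_toLp.mono fun x hx => congrArg (g x * ·) hx), Hu g hg, Hv g hg]
  exact (MemLp.toLp_eq_toLp_iff hu hv).mp this

end FiberAverageAlgebra

/-! ### The algebra of bounded Lipschitz functions -/

namespace LipAlg

variable {X : Type*} [MetricSpace X]

theorem lipschitzWith_sInf {f : X → ℝ} (hf : ∃ K : ℝ≥0, LipschitzWith K f) :
    LipschitzWith (sInf {K : ℝ≥0 | LipschitzWith K f}) f := by
  have hc : IsClosed {K : ℝ≥0 | LipschitzWith K f} := by
    have : {K : ℝ≥0 | LipschitzWith K f} = ⋂ x, ⋂ y, {K : ℝ≥0 | dist (f x) (f y) ≤ K * dist x y} := by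
      ext K
      simp only [mem_ofPred_eq, mem_iInter, lipschitzWith_iff_dist_le_mul]
    rw [this]
    exact isClosed_iInter fun x => isClosed_iInter fun y =>
      isClosed_le continuous_const (by fun_prop)
  exact hc.csInf_mem hf (OrderBot.bddBelow _)

theorem lipschitzWith_of_lipNorm_le {f : LipAlg X} {M : ℝ≥0} (h : lipNorm f ≤ M) :
    LipschitzWith M f.1 :=
  (lipschitzWith_sInf f.2).weaken (NNReal.coe_le_coe.mp ((le_max_right _ _).trans h))

theorem lipNorm_nonneg (f : LipAlg X) : 0 ≤ lipNorm f := (norm_nonneg _).trans (le_max_left _ _)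

theorem memLp_top [MeasurableSpace X] [BorelSpace X] (f : LipAlg X) (μ : Measure X) :
    MemLp f.1 ∞ μ :=
  memLp_top_of_bound f.1.continuous.measurable.aestronglyMeasurable ‖f.1‖
    (ae_of_all _ f.1.norm_coe_le_norm)

end LipAlg

/-! ### Alberti representations as measures on pairs of a fragment and a point -/

/-- The masses need not be uniformly bounded; cutting the parameter space by their integer parts
gives countably many finite kernels. -/
theorem isSFiniteKernel_of_isFiniteMeasure {Y Z : Type*} [MeasurableSpace Y] [MeasurableSpace Z]
    (κ : ProbabilityTheory.Kernel Y Z) [∀ y, IsFiniteMeasure (κ y)] :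
    ProbabilityTheory.IsSFiniteKernel κ := by
  have hm : ∀ n : ℕ, MeasurableSet {y | ⌊(κ y univ).toReal⌋₊ = n} := fun n =>
    (Nat.measurable_floor.comp (κ.measurable_coe MeasurableSet.univ).ennreal_toReal)
      (measurableSet_singleton n)
  classical
  refine ⟨⟨fun n => ProbabilityTheory.Kernel.piecewise (hm n) κ 0, fun n => ?_, ?_⟩⟩
  · refine ⟨⟨n + 1, by finiteness, fun y => ?_⟩⟩
    rw [ProbabilityTheory.Kernel.piecewise_apply]
    split_ifs with hy
    · rw [← ENNReal.ofReal_toReal (measure_ne_top (κ y) univ)]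
      have := (Nat.lt_floor_add_one (κ y univ).toReal).le
      rw [hy] at this
      refine (ENNReal.ofReal_le_ofReal this).trans_eq ?_
      rw [ENNReal.ofReal_add (by positivity) zero_le_one, ENNReal.ofReal_natCast, ENNReal.ofReal_one]
    · simp
  · ext y s hs
    rw [ProbabilityTheory.Kernel.sum_apply' _ _ hs,
      tsum_eq_single ⌊(κ y univ).toReal⌋₊ fun n hn => ?_]
    · rw [ProbabilityTheory.Kernel.piecewise_apply]
      simp
    · rw [ProbabilityTheory.Kernel.piecewise_apply, if_neg fun h => hn h.symm]
      simp

namespace AlbertiRep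

variable {X : Type*} [MetricSpace X] [MeasurableSpace X] [BorelSpace X] {μ : Measure X}

instance (A : AlbertiRep μ) : IsProbabilityMeasure A.P := A.isProbabilityMeasure

/-- The measures of an Alberti representation as a kernel. -/
noncomputable def kernel (A : AlbertiRep μ) : ProbabilityTheory.Kernel (Fragment X) X :=
  ⟨A.ν, A.measurable_ν⟩

instance (A : AlbertiRep μ) (γ : Fragment X) : IsFiniteMeasure (A.kernel γ) := A.isFiniteMeasure γ

instance (A : AlbertiRep μ) : ProbabilityTheory.IsSFiniteKernel A.kernel :=
  isSFiniteKernel_of_isFiniteMeasure _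

/-- The measure `dν_γ dP(γ)` on pairs of a fragment and a point. -/
noncomputable def total (A : AlbertiRep μ) : Measure (Fragment X × X) := A.P.compProd A.kernel

instance (A : AlbertiRep μ) : SFinite A.total := by
  rw [total]
  infer_instance

theorem measurePreserving_snd (A : AlbertiRep μ) : MeasurePreserving Prod.snd A.total μ := by
  refine ⟨measurable_snd, ?_⟩
  ext s hs
  rw [Measure.map_apply measurable_snd hs, total, Measure.compProd_apply (measurable_snd hs),
    A.represents s hs]
  rfl

theorem integral_total (A : AlbertiRep μ) {F : Fragment X × X → ℝ} (hF : Integrable F A.total) :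
    ∫ ω, F ω ∂A.total = ∫ γ, ∫ x, F (γ, x) ∂A.ν γ ∂A.P :=
  Measure.integral_compProd hF

/-- The bridge from calculus at Lebesgue-a.e. parameter of each fragment to statements a.e. on
pairs. -/
theorem ae_total_of_ae_volume (A : AlbertiRep μ) {p : Fragment X × X → Prop}
    (hp : MeasurableSet {ω | p ω})
    (h : ∀ᵐ γ ∂A.P, ∀ᵐ t : ℝ, ∀ ht : t ∈ γ.dom, p (γ, γ.toFun ⟨t, ht⟩)) :
    ∀ᵐ ω ∂A.total, p ω := by
  refine Measure.ae_compProd_of_ae_ae hp ?_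
  filter_upwards [h] with γ hγ
  filter_upwards [Fragment.ae_exists_of_ae_volume (A.absolutelyContinuous γ) hγ] with x hx
  obtain ⟨t, rfl, ht⟩ := hx
  exact ht t.2

variable [TopologicalSpace.SeparableSpace X]

theorem ae_abs_measDeriv_le (A : AlbertiRep μ) {C : ℝ≥0} (hC : ∀ᵐ γ ∂A.P, LipschitzWith C γ.toFun)
    {f : X → ℝ} {L : ℝ≥0} (hf : LipschitzWith L f) :
    ∀ᵐ ω ∂A.total, |Fragment.measDeriv f ω| ≤ L * C := by
  refine A.ae_total_of_ae_volume
    (measurableSet_le (Fragment.measurable_measDeriv hf.continuous).abs measurable_const) ?_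
  filter_upwards [hC] with γ hγ
  filter_upwards [Fragment.ae_hasDerivWithinAt_measDeriv hf hγ] with t h ht
  exact (h ht).2.2

theorem memLp_measDeriv (A : AlbertiRep μ) (hA : A.IsLipschitz)
    {f : X → ℝ} (hf : ∃ L : ℝ≥0, LipschitzWith L f) :
    MemLp (Fragment.measDeriv f) ∞ A.total := by
  obtain ⟨C, hC⟩ := hA
  obtain ⟨L, hL⟩ := hf
  exact memLp_top_of_bound (Fragment.measurable_measDeriv hL.continuous).aestronglyMeasurable _
    (A.ae_abs_measDeriv_le hC hL)

theorem ae_measDeriv_mul (A : AlbertiRep μ) (f g : LipAlg X) :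
    ∀ᵐ ω ∂A.total, Fragment.measDeriv (f * g).1 ω =
      f.1 ω.2 * Fragment.measDeriv g.1 ω + g.1 ω.2 * Fragment.measDeriv f.1 ω := by
  obtain ⟨L, hf⟩ := f.2
  obtain ⟨M, hg⟩ := g.2
  have mf := Fragment.measurable_measDeriv f.1.continuous
  have mg := Fragment.measurable_measDeriv g.1.continuous
  have cf := f.1.continuous.measurable
  have cg := g.1.continuous.measurable
  refine A.ae_total_of_ae_volume (measurableSet_eq_fun
    (Fragment.measurable_measDeriv (f * g).1.continuous) (((cf.comp measurable_snd).mul mg).add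
      ((cg.comp measurable_snd).mul mf))) (ae_of_all _ fun γ => ?_)
  obtain ⟨K, hK, -⟩ := γ.bilipschitz
  filter_upwards [Fragment.ae_hasDerivWithinAt_measDeriv hf hK,
    Fragment.ae_hasDerivWithinAt_measDeriv hg hK] with t h1 h2 ht
  refine Fragment.measDeriv_apply (t := ⟨t, ht⟩) ?_ (h1 ht).1
  have h3 := (h1 ht).2.1.mul (h2 ht).2.1
  rw [γ.pullback_apply _ ht, γ.pullback_apply _ ht] at h3
  refine (h3.congr_of_mem (fun s hs => ?_) ht).congr_deriv (by ring)
  simp only [Pi.mul_apply, γ.pullback_apply _ hs]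
  rfl

theorem ae_measDeriv_smul_add (A : AlbertiRep μ) (a b : ℝ) (f g : LipAlg X) :
    ∀ᵐ ω ∂A.total, Fragment.measDeriv (a • f + b • g).1 ω =
      a * Fragment.measDeriv f.1 ω + b * Fragment.measDeriv g.1 ω := by
  obtain ⟨L, hf⟩ := f.2
  obtain ⟨M, hg⟩ := g.2
  have mf := Fragment.measurable_measDeriv f.1.continuous
  have mg := Fragment.measurable_measDeriv g.1.continuous
  refine A.ae_total_of_ae_volume (measurableSet_eq_fun
    (Fragment.measurable_measDeriv (a • f + b • g).1.continuous) ((mf.const_mul a).add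
      (mg.const_mul b))) (ae_of_all _ fun γ => ?_)
  obtain ⟨K, hK, -⟩ := γ.bilipschitz
  filter_upwards [Fragment.ae_hasDerivWithinAt_measDeriv hf hK,
    Fragment.ae_hasDerivWithinAt_measDeriv hg hK] with t h1 h2 ht
  refine Fragment.measDeriv_apply (t := ⟨t, ht⟩) ?_ (h1 ht).1
  refine (((h1 ht).2.1.const_mul a).add ((h2 ht).2.1.const_mul b)).congr_of_mem (fun s hs => ?_) ht
  simp only [Pi.add_apply, γ.pullback_apply _ hs]
  rfl

/-- The preimage of U under a fragment is relatively open in its domain, so the two compositions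
have the same germ there. Open sets suffice for comparing h with its truncation on {|h| < n}. -/
theorem ae_measDeriv_eq_of_eqOn (A : AlbertiRep μ) {f g : X → ℝ}
    (hf : ∃ L : ℝ≥0, LipschitzWith L f) (hg : ∃ L : ℝ≥0, LipschitzWith L g) {U : Set X}
    (hU : IsOpen U) (hfg : EqOn f g U) :
    ∀ᵐ ω ∂A.total, ω.2 ∈ U → Fragment.measDeriv f ω = Fragment.measDeriv g ω := by
  obtain ⟨L, hf⟩ := hf
  obtain ⟨M, hg⟩ := hg
  have mf := Fragment.measurable_measDeriv hf.continuous
  have mg := Fragment.measurable_measDeriv hg.continuous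
  refine A.ae_total_of_ae_volume ((measurable_snd hU.measurableSet).imp
    (measurableSet_eq_fun mf mg)) (ae_of_all _ fun γ => ?_)
  obtain ⟨K, hK, -⟩ := γ.bilipschitz
  filter_upwards [Fragment.ae_hasDerivWithinAt_measDeriv hg hK] with t h1 ht htU
  refine Fragment.measDeriv_apply (t := ⟨t, ht⟩) ((h1 ht).2.1.congr_of_eventuallyEq_of_mem ?_ ht)
    (h1 ht).1
  have hV : ∀ᶠ s : γ.dom in 𝓝 ⟨t, ht⟩, γ.toFun s ∈ U :=
    γ.continuous.continuousAt.eventually (hU.mem_nhds htU)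
  rw [EventuallyEq, eventually_nhdsWithin_iff]
  rw [nhds_subtype_eq_comap, eventually_comap] at hV
  filter_upwards [hV] with s hs hsK
  rw [γ.pullback_apply _ hsK, γ.pullback_apply _ hsK]
  exact hfg (hs ⟨s, hsK⟩ rfl)

end AlbertiRep

/-! ### Weak continuity along one fragment -/

namespace Fragment

variable {X : Type*} [MetricSpace X] [MeasurableSpace X] [BorelSpace X]

theorem measurable_pullback (γ : Fragment X) {g : X → ℝ} (hg : Measurable g) :
    Measurable (γ.pullback g) :=
  (MeasurableEmbedding.subtype_coe γ.isCompact_dom.measurableSet).measurable_extend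
    (hg.comp γ.continuous.measurable) measurable_const

/-- Weak continuity of the derivative along a single fragment. -/
theorem tendsto_integral_mul_measDeriv {γ : Fragment X} {C : ℝ≥0} (hγ : LipschitzWith C γ.toFun)
    {ρ : Measure X} [IsFiniteMeasure ρ]
    (hρ : ρ ≪ (Measure.hausdorffMeasure 1 : Measure X).restrict (range γ.toFun)) {L : ℝ≥0}
    {u : ℕ → X → ℝ} {f : X → ℝ} (hu : ∀ n, LipschitzWith L (u n)) (hf : LipschitzWith L f)
    (hlim : ∀ x, Tendsto (fun n => u n x) atTop (𝓝 (f x))) {g : X → ℝ} (hgm : Measurable g)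
    (hg : Integrable g ρ) :
    Tendsto (fun n => ∫ x, g x * measDeriv (u n) (γ, x) ∂ρ) atTop
      (𝓝 (∫ x, g x * measDeriv f (γ, x) ∂ρ)) := by
  have hσ := map_param_absolutelyContinuous hρ
  have hex : ∀ᵐ x ∂ρ, ∃ t : γ.dom, γ t = x :=
    (ae_exists_of_ae_volume hρ (p := fun _ => True) (ae_of_all _ fun _ => trivial)).mono
      fun x ⟨t, ht, _⟩ => ⟨t, ht⟩
  have hσK : ∀ᵐ t ∂ρ.map γ.param, t ∈ γ.dom := by
    refine (ae_map_iff γ.measurable_param.aemeasurable γ.isCompact_dom.measurableSet).mpr ?_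
    filter_upwards [hex]
    rintro _ ⟨t, rfl⟩
    rw [param_apply]
    exact t.2
  have hgp : ∀ᵐ x ∂ρ, γ.pullback g (γ.param x) = g x := by
    filter_upwards [hex]
    rintro _ ⟨t, rfl⟩
    rw [param_apply, pullback_apply γ g t.2]
  have hpm := γ.measurable_pullback hgm
  have hgi : Integrable (γ.pullback g) (ρ.map γ.param) := by
    rw [integrable_map_measure hpm.aestronglyMeasurable γ.measurable_param.aemeasurable]
    exact hg.congr (hgp.mono fun x hx => hx.symm)
  -- Change of variables by the inverse of γ: the image of ρ is absolutely continuous on the line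
  -- and concentrated on the domain of γ.
  have e : ∀ v : X → ℝ, LipschitzWith L v → ∫ x, g x * measDeriv v (γ, x) ∂ρ =
      ∫ t, γ.pullback g t * derivWithin (γ.pullback v) γ.dom t ∂ρ.map γ.param := by
    intro v hv
    rw [integral_map γ.measurable_param.aemeasurable (hpm.aestronglyMeasurable.fun_mul
      (aestronglyMeasurable_derivWithin hσ hσK (lipschitzOnWith_pullback hv hγ)))]
    refine integral_congr_ae ?_
    filter_upwards [ae_measDeriv hv hγ hρ, hgp, hex] with x h1 h2 h3
    obtain ⟨t, rfl⟩ := h3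
    rw [h2, h1.1, partialDeriv_apply, param_apply]
    rfl
  rw [e f hf]
  simp only [fun n => e (u n) (hu n)]
  refine tendsto_integral_mul_derivWithin γ.isCompact_dom hσ hσK hgi
    (fun n => lipschitzOnWith_pullback (hu n) hγ) (lipschitzOnWith_pullback hf hγ) fun t ht => ?_
  simp only [γ.pullback_apply _ ht]
  exact hlim _

end Fragment

/-! ### The derivation associated with a representation -/

namespace AlbertiRep

variable {X : Type*} [MetricSpace X] [MeasurableSpace X] [BorelSpace X] {μ : Measure X}
  [TopologicalSpace.SeparableSpace X]

theorem integral_mul_measDeriv (A : AlbertiRep μ) {C : ℝ≥0}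
    (hC : ∀ᵐ γ ∂A.P, LipschitzWith C γ.toFun) {f : X → ℝ} (hf : ∃ L : ℝ≥0, LipschitzWith L f)
    {g : X → ℝ} (hg : Integrable g μ) :
    ∫ ω, g ω.2 * Fragment.measDeriv f ω ∂A.total =
      ∫ γ, ∫ x, g x * Fragment.measDeriv f (γ, x) ∂A.ν γ ∂A.P :=
  A.integral_total ((A.measurePreserving_snd.integrable_comp_of_integrable hg).mul_of_top_left
    (A.memLp_measDeriv ⟨C, hC⟩ hf))

/-- For a.e. γ the inner integrals converge by the one-fragment case. They are dominated by LC ∫ |g|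
dν_γ, which is P-integrable because the pair measure projects to μ. -/
theorem tendsto_integral_mul_measDeriv (A : AlbertiRep μ) {C : ℝ≥0}
    (hC : ∀ᵐ γ ∂A.P, LipschitzWith C γ.toFun) {L : ℝ≥0} {u : ℕ → X → ℝ} {f : X → ℝ}
    (hu : ∀ n, LipschitzWith L (u n)) (hf : LipschitzWith L f)
    (hlim : ∀ x, Tendsto (fun n => u n x) atTop (𝓝 (f x))) {g : X → ℝ} (hgm : Measurable g)
    (hg : Integrable g μ) :
    Tendsto (fun n => ∫ ω, g ω.2 * Fragment.measDeriv (u n) ω ∂A.total) atTop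
      (𝓝 (∫ ω, g ω.2 * Fragment.measDeriv f ω ∂A.total)) := by
  rw [A.integral_mul_measDeriv hC ⟨L, hf⟩ hg]
  simp only [fun n => A.integral_mul_measDeriv hC ⟨L, hu n⟩ hg]
  have hgt : Integrable (fun ω : Fragment X × X => g ω.2) A.total :=
    A.measurePreserving_snd.integrable_comp_of_integrable hg
  have hgt' := (Measure.integrable_compProd_iff hgt.1).mp hgt
  refine tendsto_integral_of_dominated_convergence (fun γ => (∫ x, ‖g x‖ ∂A.ν γ) * (L * C))
    (fun n => ?_) (hgt'.2.mul_const _) (fun n => ?_) ?_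
  · exact (hgt.mul_of_top_left (A.memLp_measDeriv ⟨C, hC⟩ ⟨L, hu n⟩)).1.integral_kernel_compProd
  · filter_upwards [hC, hgt'.1] with γ hγ hgγ
    rw [← integral_mul_const]
    refine norm_integral_le_of_norm_le (hgγ.norm.mul_const _) ?_
    filter_upwards [Fragment.ae_measDeriv (hu n) hγ (A.absolutelyContinuous γ)] with x hx
    rw [norm_mul]
    exact mul_le_mul_of_nonneg_left hx.2 (norm_nonneg _)
  · filter_upwards [hC, hgt'.1] with γ hγ hgγ
    have := A.isFiniteMeasure γ
    exact Fragment.tendsto_integral_mul_measDeriv hγ (A.absolutelyContinuous γ) hu hf hlim hgm hgγ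

/-- The fibre average of the derivatives along fragments is the derivation induced by `A`. -/
theorem induces_of_isFiberAverage (A : AlbertiRep μ) (hA : A.IsLipschitz) {D : WeaverDerivation μ}
    (hD : ∀ f : LipAlg X, IsFiberAverage A.total μ Prod.snd (Fragment.measDeriv f.1) (D.toLin f)) :
    A.Induces D := by
  intro f g _ _ hg
  obtain ⟨C, hC⟩ := hA
  rw [hD f g hg, A.integral_mul_measDeriv hC f.2 hg]
  refine integral_congr_ae ?_
  obtain ⟨L, hL⟩ := f.2
  filter_upwards [hC] with γ hγ
  refine integral_congr_ae ?_
  filter_upwards [Fragment.ae_measDeriv hL hγ (A.absolutelyContinuous γ)] with x hx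
  rw [hx.1]

variable [IsLocallyFiniteMeasure μ]

theorem exists_isFiberAverage_measDeriv (A : AlbertiRep μ) {C : ℝ≥0}
    (hC : ∀ᵐ γ ∂A.P, LipschitzWith C γ.toFun) {f : X → ℝ} {L : ℝ≥0} (hf : LipschitzWith L f) :
    ∃ u : X → ℝ, Measurable u ∧ (∀ᵐ x ∂μ, |u x| ≤ L * C) ∧
      IsFiberAverage A.total μ Prod.snd (Fragment.measDeriv f) u := by
  have : SecondCountableTopology X := UniformSpace.secondCountable_of_separable X
  exact exists_isFiberAverage A.measurePreserving_snd
    (Fragment.measurable_measDeriv hf.continuous) (by positivity) (A.ae_abs_measDeriv_le hC hf)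

/-- Each algebraic identity compares two bounded fibre averages of the same function on pairs, so it
follows from uniqueness. -/
theorem exists_weaverDerivation (A : AlbertiRep μ) (hA : A.IsLipschitz) :
    ∃ D : WeaverDerivation μ, ∀ f : LipAlg X,
      IsFiberAverage A.total μ Prod.snd (Fragment.measDeriv f.1) (D.toLin f) := by
  have : SecondCountableTopology X := UniformSpace.secondCountable_of_separable X
  obtain ⟨C, hC⟩ := id hA
  have hT : ∀ f : LipAlg X, ∃ u : Lp ℝ ∞ μ, ‖u‖ ≤ C * lipNorm f ∧
      IsFiberAverage A.total μ Prod.snd (Fragment.measDeriv f.1) u := by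
    intro f
    obtain ⟨u, hum, hub, hu⟩ := A.exists_isFiberAverage_measDeriv hC
      (LipAlg.lipschitzWith_of_lipNorm_le (M := (lipNorm f).toNNReal) (Real.le_coe_toNNReal _))
    rw [Real.coe_toNNReal _ (LipAlg.lipNorm_nonneg f)] at hub
    have hup : MemLp u ∞ μ := memLp_top_of_bound hum.aestronglyMeasurable _ hub
    refine ⟨hup.toLp u, ?_, hu.congr (ae_eq_refl _) hup.coeFn_toLp.symm⟩
    rw [Lp.norm_toLp, eLpNorm_exponent_top, mul_comm]
    exact ENNReal.toReal_le_of_le_ofReal (mul_nonneg (LipAlg.lipNorm_nonneg f) C.coe_nonneg)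
      (eLpNormEssSup_le_of_ae_bound hub)
  choose T hTn hTavg using hT
  have hlin : ∀ (a b : ℝ) (f g : LipAlg X), T (a • f + b • g) = a • T f + b • T g := by
    intro a b f g
    have h1 := ((hTavg f).mul_add_mul A.measurePreserving_snd (A.memLp_measDeriv hA f.2)
      (A.memLp_measDeriv hA g.2) (Lp.memLp _) (Lp.memLp _) (hTavg g) (memLp_top_const a)
      (memLp_top_const b)).congr (EventuallyEq.symm (A.ae_measDeriv_smul_add a b f g))
      (ae_eq_refl _)
    have h2 : (fun x => a * T f x + b * T g x) =ᵐ[μ] ⇑(a • T f + b • T g) := by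
      filter_upwards [Lp.coeFn_add (a • T f) (b • T g), Lp.coeFn_smul a (T f),
        Lp.coeFn_smul b (T g)] with x h1 h2 h3
      rw [h1, Pi.add_apply, h2, h3]
      rfl
    exact Lp.ext ((hTavg _).ae_eq (Lp.memLp _) (Lp.memLp _) (h1.congr (ae_eq_refl _) h2))
  refine ⟨⟨⟨⟨T, fun f g => ?_⟩, fun a f => ?_⟩, ⟨C, hTn⟩, fun f g => ?_, ?_⟩, hTavg⟩
  · simpa using hlin 1 1 f g
  · simpa using hlin a 0 f 0
  · refine (hTavg _).ae_eq (Lp.memLp _) ?_ ?_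
    · exact ((Lp.memLp (T g)).mul (LipAlg.memLp_top f μ)).add
        ((Lp.memLp (T f)).mul (LipAlg.memLp_top g μ))
    · exact ((hTavg g).mul_add_mul A.measurePreserving_snd (A.memLp_measDeriv hA g.2)
        (A.memLp_measDeriv hA f.2) (Lp.memLp _) (Lp.memLp _) (hTavg f) (LipAlg.memLp_top f μ)
        (LipAlg.memLp_top g μ)).congr (EventuallyEq.symm (A.ae_measDeriv_mul f g)) (ae_eq_refl _)
  · rintro u f ⟨M, hM⟩ hlim g hg
    -- Restricting the test function to single fragments requires a genuinely measurable
    -- representative.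
    set g' := hg.1.mk g with hg'
    have hgg' : g =ᵐ[μ] g' := hg.1.ae_eq_mk
    have e : ∀ v : X → ℝ, ∫ x, g x * v x ∂μ = ∫ x, g' x * v x ∂μ := fun v =>
      integral_congr_ae (hgg'.mono fun x hx => congrArg (· * v x) hx)
    have hgi : Integrable g' μ := hg.congr hgg'
    simp only [e]
    simp only [LinearMap.coe_mk, AddHom.coe_mk, hTavg _ _ hgi]
    -- One Lipschitz constant for the whole sequence and its limit.
    set L : ℝ≥0 := (max M (lipNorm f)).toNNReal with hL
    have hML : max M (lipNorm f) ≤ L := Real.le_coe_toNNReal _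
    exact A.tendsto_integral_mul_measDeriv hC
      (fun n => LipAlg.lipschitzWith_of_lipNorm_le ((hM n).trans ((le_max_left _ _).trans hML)))
      (LipAlg.lipschitzWith_of_lipNorm_le ((le_max_right _ _).trans hML)) hlim
      hg.1.stronglyMeasurable_mk.measurable hgi

theorem Induces.eq {A : AlbertiRep μ} {D D' : WeaverDerivation μ} (hD : A.Induces D)
    (hD' : A.Induces D') : D = D' := by
  have : SecondCountableTopology X := UniformSpace.secondCountable_of_separable X
  ext1
  ext1 f
  exact ae_eq_of_forall_integral_mul_eq _ _ fun g hgm hgb hg =>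
    (hD f g hgm hgb hg).trans (hD' f g hgm hgb hg).symm

theorem existsUnique_induces (A : AlbertiRep μ) (hA : A.IsLipschitz) :
    ∃! D : WeaverDerivation μ, A.Induces D := by
  obtain ⟨D, hD⟩ := A.exists_weaverDerivation hA
  exact ⟨D, A.induces_of_isFiberAverage hA hD, fun D' hD' =>
    hD'.eq (A.induces_of_isFiberAverage hA hD)⟩

/-- `derivation` is an arbitrary choice among induced derivations; uniqueness identifies it with the
one built from fibre averages. -/
theorem isFiberAverage_derivation (A : AlbertiRep μ) (hA : A.IsLipschitz) (f : LipAlg X) :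
    IsFiberAverage A.total μ Prod.snd (Fragment.measDeriv f.1) (A.derivation.toLin f) := by
  obtain ⟨D, hD⟩ := A.exists_weaverDerivation hA
  have hi := A.induces_of_isFiberAverage hA hD
  have h : ∃ D, A.Induces D := ⟨D, hi⟩
  have : A.derivation = D := by
    rw [derivation, dif_pos h]
    exact h.choose_spec.eq hi
  rw [this]
  exact hD f

end AlbertiRep

/-! ### Unbounded Lipschitz maps, cone directions and independence -/

theorem trunc_apply_of_abs_lt {X : Type*} [MetricSpace X] {h : X → ℝ}
    (hh : ∃ K : ℝ≥0, LipschitzWith K h) {n : ℕ} {x : X} (hx : |h x| < n) :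
    (trunc h hh n).1 x = h x := by
  rw [abs_lt] at hx
  change max (min (h x) n) (-(n : ℝ)) = h x
  rw [min_eq_left hx.2.le, max_eq_left hx.1.le]

theorem exists_lipschitzWith_coord {X : Type*} [MetricSpace X] {q : ℕ}
    {f : X → EuclideanSpace ℝ (Fin q)} (hf : ∃ K : ℝ≥0, LipschitzWith K f) (j : Fin q) :
    ∃ K : ℝ≥0, LipschitzWith K fun x => f x j :=
  hf.imp fun _ hK => LipschitzWith.of_dist_le_mul fun y z =>
    (PiLp.dist_apply_le (f y) (f z) j).trans (hK.dist_le_mul y z)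

namespace AlbertiRep

variable {X : Type*} [MetricSpace X] [MeasurableSpace X] [BorelSpace X] {μ : Measure X}
  [TopologicalSpace.SeparableSpace X]

theorem ae_measDeriv_mem_coneAt (A : AlbertiRep μ) {q : ℕ} {f : X → EuclideanSpace ℝ (Fin q)}
    (hf : ∃ K : ℝ≥0, LipschitzWith K f) {C : ConeField X q} (hAC : A.InDirection f C) :
    ∀ᵐ ω ∂A.total, (WithLp.toLp 2 fun j => Fragment.measDeriv (fun x => f x j) ω) ∈
      C.coneAt ω.2 := by
  have hm : ∀ j, Measurable (Fragment.measDeriv fun x => f x j : Fragment X × X → ℝ) := fun j =>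
    Fragment.measurable_measDeriv (exists_lipschitzWith_coord hf j).choose_spec.continuous
  refine A.ae_total_of_ae_volume (measurableSet_coneAt_comp C measurable_snd (by fun_prop)) ?_
  filter_upwards [hAC] with γ hγ
  filter_upwards [hγ, ae_uniqueDiffWithinAt_real γ.dom] with t h1 h2 ht
  -- `derivWithin` is 0 where the derivative fails to exist, and the cone omits 0, so membership in
  -- the cone forces differentiability.
  have hne : γ.derivAlong f t ≠ 0 := fun h0 => zero_notMem_cone (h0 ▸ h1 ht)
  have hd : HasDerivWithinAt (γ.pullback f) (γ.derivAlong f t) γ.dom t :=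
    (differentiableWithinAt_of_derivWithin_ne_zero hne).hasDerivWithinAt
  convert! h1 ht using 1
  ext j
  refine Fragment.measDeriv_apply (t := ⟨t, ht⟩) ?_ (h2 ht)
  refine ((EuclideanSpace.proj (𝕜 := ℝ) j).hasFDerivAt.comp_hasDerivWithinAt t hd).congr_of_mem
    (fun s hs => ?_) ht
  rw [γ.pullback_apply _ hs, Function.comp_apply, γ.pullback_apply _ hs]
  rfl

variable [IsLocallyFiniteMeasure μ]

/-- Fibre averages make sense for unbounded h, since its derivative is still bounded. Multiplying by
the indicator of {|h| < n} localises the comparison with the truncation at level n. -/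
theorem ae_applyLip_eq (A : AlbertiRep μ) (hA : A.IsLipschitz) {h u : X → ℝ}
    (hh : ∃ K : ℝ≥0, LipschitzWith K h) (hu : MemLp u ∞ μ)
    (hav : IsFiberAverage A.total μ Prod.snd (Fragment.measDeriv h) u) :
    A.derivation.applyLip h hh =ᵐ[μ] u := by
  have : SecondCountableTopology X := UniformSpace.secondCountable_of_separable X
  have hc : Continuous h := hh.choose_spec.continuous
  have key : ∀ n : ℕ, ∀ᵐ x ∂μ, |h x| < n → A.derivation.toLin (trunc h hh n) x = u x := by
    intro n
    have hU : IsOpen {x | |h x| < n} := isOpen_lt hc.abs continuous_const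
    set a : X → ℝ := {x | |h x| < n}.indicator 1 with ha
    have hap : MemLp a ∞ μ := (memLp_top_const (1 : ℝ)).indicator hU.measurableSet
    have h0 : MemLp (0 : X → ℝ) ∞ μ := MemLp.zero
    have hD : MemLp (A.derivation.toLin (trunc h hh n)) ∞ μ := Lp.memLp _
    -- Only multiplication by the indicator is needed, so the second coefficient is taken to be 0.
    have h1 := (A.isFiberAverage_derivation hA (trunc h hh n)).mul_add_mul A.measurePreserving_snd
      (A.memLp_measDeriv hA (trunc h hh n).2) (A.memLp_measDeriv hA hh) hD hu hav hap h0
    have h2 := hav.mul_add_mul A.measurePreserving_snd (A.memLp_measDeriv hA hh)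
      (A.memLp_measDeriv hA hh) hu hu hav hap h0
    have h3 := h1.congr (u' := fun x => a x * A.derivation.toLin (trunc h hh n) x + 0 * u x)
      (h' := fun ω => a ω.2 * Fragment.measDeriv h ω + 0 * Fragment.measDeriv h ω)
      (by
        filter_upwards [A.ae_measDeriv_eq_of_eqOn (trunc h hh n).2 hh hU
          fun x hx => trunc_apply_of_abs_lt hh hx] with ω hω
        by_cases hx : ω.2 ∈ {x | |h x| < n}
        · rw [hω hx]
          rfl
        · simp [ha, hx]) (ae_eq_refl _)
    have h4 := h3.ae_eq (((hD.mul hap)).add (hu.mul h0)) ((hu.mul hap).add (hu.mul h0)) h2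
    filter_upwards [h4] with x hx hxn
    simpa [ha, hxn.not_ge] using hx
  filter_upwards [ae_all_iff.mpr key] with x hx
  -- The level ⌊|h x|⌋ + 1 used by `applyLip` is strictly larger than |h x|.
  exact hx _ (by exact_mod_cast Nat.lt_floor_add_one |h x|)

theorem ae_applyVec_mem_coneAt (A : AlbertiRep μ) (hA : A.IsLipschitz) {q : ℕ}
    {f : X → EuclideanSpace ℝ (Fin q)} (hf : ∃ K : ℝ≥0, LipschitzWith K f) {C : ConeField X q}
    (hAC : A.InDirection f C) : ∀ᵐ x ∂μ, A.derivation.applyVec f hf x ∈ C.coneAt x := by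
  have : SecondCountableTopology X := UniformSpace.secondCountable_of_separable X
  obtain ⟨K, hK⟩ := hA
  obtain ⟨L, hL⟩ := id hf
  have hLj : ∀ j, LipschitzWith L fun x => f x j := fun j => LipschitzWith.of_dist_le_mul
    fun y z => (PiLp.dist_apply_le (f y) (f z) j).trans (hL.dist_le_mul y z)
  choose u hum hub hu using fun j => A.exists_isFiberAverage_measDeriv hK (hLj j)
  have hm : ∀ j, Measurable (Fragment.measDeriv fun x => f x j : Fragment X × X → ℝ) := fun j =>
    Fragment.measurable_measDeriv (hLj j).continuous
  have hcone := ae_mem_coneAt_of_isFiberAverage A.measurePreserving_snd C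
    (U := fun x => WithLp.toLp 2 fun j => u j x) (by fun_prop)
    (V := fun ω => WithLp.toLp 2 fun j => Fragment.measDeriv (fun x => f x j) ω) (by fun_prop)
    (ae_all_iff.mpr hub) (ae_all_iff.mpr fun j => A.ae_abs_measDeriv_le hK (hLj j)) hu
    (A.ae_measDeriv_mem_coneAt hf hAC)
  have hap : ∀ᵐ x ∂μ, ∀ j,
      A.derivation.applyLip (fun y => f y j) (exists_lipschitzWith_coord hf j) x = u j x :=
    ae_all_iff.mpr fun j => A.ae_applyLip_eq ⟨K, hK⟩ _
      (memLp_top_of_bound (hum j).aestronglyMeasurable _ (hub j)) (hu j)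
  filter_upwards [hcone, hap] with x h1 h2
  convert! h1 using 1
  ext j
  exact h2 j

end AlbertiRep

/-- If derivations map `f` a.e. to linearly independent vectors, then they are independent. -/
theorem WeaverDerivation.linIndep_of_ae_linearIndependent {X : Type*} [MetricSpace X]
    [MeasurableSpace X] {μ : Measure X} {k q : ℕ} {D : Fin k → WeaverDerivation μ}
    {f : X → EuclideanSpace ℝ (Fin q)} (hf : ∃ K : ℝ≥0, LipschitzWith K f)
    (h : ∀ᵐ x ∂μ, LinearIndependent ℝ fun i => (D i).applyVec f hf x) : LinIndep D := by
  intro c hc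
  have hsum : ∀ g : LipAlg X, ∀ᵐ x ∂μ, ∑ i, c i x * (D i).toLin g x = 0 := by
    intro g
    have h1 : ∀ᵐ x ∂μ, ∀ i, (c i • (D i).toLin g : Lp ℝ ∞ μ) x = c i x * (D i).toLin g x :=
      ae_all_iff.mpr fun i => Lp.coeFn_lpSMul (c i) ((D i).toLin g)
    have h2 := Lp.coeFn_finsetSum Finset.univ fun i => (c i • (D i).toLin g : Lp ℝ ∞ μ)
    rw [hc g] at h2
    filter_upwards [h1, h2, Lp.coeFn_zero ℝ ∞ μ] with x h1 h2 h3
    rw [h3, Finset.sum_apply] at h2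
    simp only [← h1]
    exact h2.symm
  -- The truncation level in `applyLip` varies with x, so one null set must serve all levels and
  -- coordinates at once.
  have hall : ∀ᵐ x ∂μ, ∀ (j : Fin q) (n : ℕ), ∑ i, c i x *
      (D i).toLin (trunc (fun y => f y j) (exists_lipschitzWith_coord hf j) n) x = 0 :=
    ae_all_iff.mpr fun j => ae_all_iff.mpr fun n => hsum _
  have hzero : ∀ᵐ x ∂μ, ∀ i, c i x = 0 := by
    filter_upwards [h, hall] with x hx hx0
    refine Fintype.linearIndependent_iff.mp hx (fun i => c i x) ?_
    ext j
    simp only [WithLp.ofLp_sum, WithLp.ofLp_smul, Finset.sum_apply, Pi.smul_apply, smul_eq_mul]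
    exact hx0 j _
  intro i
  refine Lp.ext ?_
  filter_upwards [hzero, Lp.coeFn_zero ℝ ∞ μ] with x h1 h2
  rw [h1, h2]
  rfl

end AlbertiDer

theorem mainTheorem8 {X : Type*} [MetricSpace X] [TopologicalSpace.SeparableSpace X]
    [MeasurableSpace X] [BorelSpace X]
    (μ : MeasureTheory.Measure X) [MeasureTheory.IsLocallyFiniteMeasure μ]
    [MeasureTheory.Measure.InnerRegular μ]
    {q : ℕ} (f : X → EuclideanSpace ℝ (Fin q)) (hf : ∃ K : ℝ≥0, LipschitzWith K f) :
    (∀ (C : AlbertiDer.ConeField X q) (A : AlbertiDer.AlbertiRep μ),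
      A.IsLipschitz → A.InDirection f C →
        (∃! D : AlbertiDer.WeaverDerivation μ, A.Induces D) ∧
        ∀ᵐ x ∂μ, A.derivation.applyVec f hf x ∈ C.coneAt x) ∧
    (∀ (k : ℕ) (C : Fin k → AlbertiDer.ConeField X q) (A : Fin k → AlbertiDer.AlbertiRep μ),
      AlbertiDer.IndepConeFields C →
      (∀ i, (A i).IsLipschitz) → (∀ i, (A i).InDirection f (C i)) →
        AlbertiDer.WeaverDerivation.LinIndep (fun i => (A i).derivation)) := by
  refine ⟨fun C A hA hAC => ⟨A.existsUnique_induces hA, A.ae_applyVec_mem_coneAt hA hf hAC⟩,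
    fun k C A hC hA hAC => ?_⟩
  refine AlbertiDer.WeaverDerivation.linIndep_of_ae_linearIndependent hf ?_
  filter_upwards [ae_all_iff.mpr fun i => (A i).ae_applyVec_mem_coneAt (hA i) hf (hAC i)] with x hx
  exact hC x _ fun i => ⟨hx i, fun h0 => AlbertiDer.zero_notMem_cone (h0 ▸ hx i)⟩
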